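/- Let $L=\{E_n : n\in\omega\}$ be the language with countably many binary relation symbols, and let $\mathrm{REF}(\mathrm{bin})$ be the first-order $L$-theory asserting that each $E_n$ is an equivalence relation, that $E_0$ has a single class, that each $E_{n+1}$ refines $E_n$, and that each $E_n$-class is partitioned into exactly two $E_{n+1}$-classes. Let $\mathrm{Mod}(\mathrm{REF}(\mathrm{bin}))$ be the space of models of $\mathrm{REF}(\mathrm{bin})$ with universe $\omega$, with the logic topology (in which, for all $n,a,b\in\omega$, the truth value of $E_n(a,b)$ is a clopen condition, and which is generated by these conditions). For $L$-structures $M,N$ and an ordinal $\alpha$, finite tuples $\bar a\in M^k$, $\bar b\in N^k$ are $\alpha$-equivalent, written $(M,\bar a)\equiv_\alpha(N,\bar b)$, if they satisfy the same first-order formulas and, for every $\beta<\alpha$: for every $c\in M$ there is $d\in N$ with $(M,\bar a c)\equiv_\beta(N,\bar b d)$, and for every $d\in N$ there is $c\in M$ with $(M,\bar a c)\equiv_\beta(N,\bar b d)$. Write $M\equiv_\alpha N$ when this holds for the empty tuples. **Theorem.** The isomorphism relation on $\mathrm{Mod}(\mathrm{REF}(\mathrm{bin}))$ is not a Borel subset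 of $\mathrm{Mod}(\mathrm{REF}(\mathrm{bin}))\times\mathrm{Mod}(\mathrm{REF}(\mathrm{bin}))$. Moreover, for every $\alpha<\omega_1$ there are countable models $M,N$ of $\mathrm{REF}(\mathrm{bin})$ (with universe $\omega$) such that $M\equiv_\alpha N$ but $M\not\cong N$. -/

import Mathlib

open scoped FirstOrder

namespace RefBin

/-- The relation symbols of the language `{E n : n ∈ ℕ}`, each of them binary. -/
inductive Rel : ℕ → Type
  | E (n : ℕ) : Rel 2

/-- The language `{E n : n ∈ ℕ}` of countably many binary relation symbols. -/
def lang : FirstOrder.Language.{0, 0} := ⟨fun _ => Empty, Rel⟩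

/-- The symbol `E n`. -/
def sym (n : ℕ) : lang.Relations 2 := Rel.E n

/-- The atomic formula `E n x_i x_j`. -/
def atom {k : ℕ} (n : ℕ) (i j : Fin k) : lang.BoundedFormula Empty k :=
  (sym n).boundedFormula₂ (&i) (&j)

/-- `E 0` consists of a single class: `∀ x y, E 0 x y`. -/
def trivialAxiom : lang.Sentence := ∀' ∀' (atom 0 0 1)

/-- `E (n + 1)` refines `E n`: `∀ x y, E (n + 1) x y → E n x y`. -/
def refineAxiom (n : ℕ) : lang.Sentence := ∀' ∀' (atom (n + 1) 0 1 ⟹ atom n 0 1)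

/-- Every `E n`-class is the union of exactly two `E (n + 1)`-classes:
`∀ x, ∃ y, E n x y ∧ ¬ E (n + 1) x y ∧ ∀ z, E n x z → E (n + 1) x z ∨ E (n + 1) y z`. -/
def splitAxiom (n : ℕ) : lang.Sentence :=
  ∀' ∃' (atom n 0 1 ⊓ (∼(atom (n + 1) 0 1) ⊓
    ∀' (atom n 0 2 ⟹ (atom (n + 1) 0 2 ⊔ atom (n + 1) 1 2))))

/-- The first-order theory REF(bin) of binary splitting, refining equivalence relations. -/
def REFbin : lang.Theory :=
  Set.range (fun n => (sym n).reflexive) ∪ Set.range (fun n => (sym n).symmetric) ∪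
    Set.range (fun n => (sym n).transitive) ∪ {trivialAxiom} ∪
    Set.range refineAxiom ∪ Set.range splitAxiom

end RefBin

namespace CountableModels

universe u v

/-- The space `X_L` of `L`-structures with universe `ℕ`. -/
def StructureSpace (L : FirstOrder.Language.{u, v}) : Type (max u v) := L.Structure ℕ

/-- The logic topology on `X_L`: the truth value of each atomic fact about given natural numbers
is a clopen condition. -/
instance (L : FirstOrder.Language.{u, v}) : TopologicalSpace (StructureSpace L) :=
  TopologicalSpace.generateFrom
    ({U | ∃ (n : ℕ) (R : L.Relations n) (x : Fin n → ℕ),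
        U = {M : StructureSpace L | @FirstOrder.Language.Structure.RelMap L ℕ M n R x}} ∪
      {U | ∃ (n : ℕ) (R : L.Relations n) (x : Fin n → ℕ),
        U = {M : StructureSpace L | ¬ @FirstOrder.Language.Structure.RelMap L ℕ M n R x}} ∪
      {U | ∃ (n : ℕ) (f : L.Functions n) (x : Fin n → ℕ) (y : ℕ),
        U = {M : StructureSpace L | @FirstOrder.Language.Structure.funMap L ℕ M n f x = y}})

/-- `Mod(T)`, the set of models of `T` with universe `ℕ`. As a subtype it carries the subspace
topology. -/
def ModelSpace {L : FirstOrder.Language.{u, v}} (T : L.Theory) : Set (StructureSpace L) :=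
  {M | @FirstOrder.Language.Theory.Model L ℕ M T}

/-- Isomorphism of `L`-structures with universe `ℕ`. -/
def Iso {L : FirstOrder.Language.{u, v}} (M N : StructureSpace L) : Prop :=
  Nonempty (@FirstOrder.Language.Equiv L ℕ ℕ M N)

/-- Isomorphism on `Mod(T)` is Borel: it is a Borel subset of `Mod(T) × Mod(T)` (the Borel
σ-algebra being generated by the product topology). -/
def IsomorphismIsBorel {L : FirstOrder.Language.{u, v}} (T : L.Theory) : Prop :=
  @MeasurableSet (ModelSpace T × ModelSpace T) (borel (ModelSpace T × ModelSpace T))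
    {p : ModelSpace T × ModelSpace T | Iso p.1.1 p.2.1}

/-- The map `a i ↦ b i` is partial elementary from `M` to `N`. -/
def PartialElementary {L : FirstOrder.Language.{u, v}} (M N : StructureSpace L) {n : ℕ}
    (a b : Fin n → ℕ) : Prop :=
  ∀ φ : L.Formula (Fin n),
    @FirstOrder.Language.Formula.Realize L ℕ M (Fin n) φ a ↔
      @FirstOrder.Language.Formula.Realize L ℕ N (Fin n) φ b

/-- Player II wins the following game from the position `(a, b)`, with the clock at `α`. On each
turn Player I lowers the clock to some ordinal `β < α` and picks an element of `M` or of `N`;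
Player II answers with an element of the other structure; and Player II has to keep the map from
the chosen elements of `M` to the chosen elements of `N` partial elementary. -/
def PlayerTwoWins {L : FirstOrder.Language.{u, v}} (M N : StructureSpace L)
    (α : Ordinal.{0}) {n : ℕ} (a b : Fin n → ℕ) : Prop :=
  PartialElementary M N a b ∧ ∀ β : Ordinal.{0}, β < α →
    (∀ c : ℕ, ∃ d : ℕ, PlayerTwoWins M N β (Fin.snoc a c : Fin (n + 1) → ℕ) (Fin.snoc b d)) ∧
    (∀ d : ℕ, ∃ c : ℕ, PlayerTwoWins M N β (Fin.snoc a c : Fin (n + 1) → ℕ) (Fin.snoc b d))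
termination_by α

/-- `M ≡_α N`: Player II wins the game of length `α` from the empty position. -/
def EquivUpTo {L : FirstOrder.Language.{u, v}} (α : Ordinal.{0}) (M N : StructureSpace L) : Prop :=
  PlayerTwoWins M N α (Fin.elim0 : Fin 0 → ℕ) Fin.elim0

end CountableModels

/-!
If isomorphism on `Mod(T)` is Borel, then for some countable `α` the relation `≡_α` implies
isomorphism. To see this, enumerate a structure `N` along a generic injection `g : ℕ → ℕ`. A Borel
property of the enumerated structure is forced by finitely many values of `g`, and an induction over
the Borel sets shows that the forcing relation depends only on the `≡_α`-type of these values in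
`N`, for some `α < ω₁`. Generic injections are onto, so this applies to the isomorphism class of
any `M`, with an `α` that does not depend on `M`.

It remains to find models of `REFbin` that are `≡_α` but not isomorphic. A countable model is a
binary tree whose branches carry multiplicities, and elementary equivalence costs nothing because of
quantifier elimination, so that the game can be played on trees. For `α = 0` take two constant
multiplicities. For `α > 0` choose a sequence of ordinals `s n < α` that is eventually at least `γ`
for every `γ < α`, take pairs `P n`, `Q n` of trees that work for `s n` by induction, and hang `P n`
or `Q n` beside the edges of the `n`-th level of the full binary tree, according to the direction of
the edge. The hanging trees make the full binary tree rigid. Let the branches in a countable dense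
set `Z` be present with multiplicity 2. Taking for `Z` the branches that are eventually `false` or
eventually `true` gives trees that are not isomorphic. But with the clock at `γ < α` only finitely
many levels show the directions of their edges, and a branch in one `Z` can be answered by a branch
in the other one that agrees with it on these levels.
-/

namespace CountableModels

open FirstOrder FirstOrder.Language Topology Filter Ordinal
open scoped MeasureTheory

section Agree

variable {A : Type*} {m n : ℕ} {x y z : ℕ → A}

/-- The sequences `x` and `y` have the same initial segment of length `n`. -/
def Agree (n : ℕ) (x y : ℕ → A) : Prop := ∀ k < n, x k = y k

theorem Agree.refl (n : ℕ) (x : ℕ → A) : Agree n x x := fun _ _ => rfl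

theorem Agree.symm (h : Agree n x y) : Agree n y x := fun k hk => (h k hk).symm

theorem Agree.trans (h : Agree n x y) (h' : Agree n y z) : Agree n x z :=
  fun k hk => (h k hk).trans (h' k hk)

theorem Agree.mono (h : m ≤ n) (hxy : Agree n x y) : Agree m x y :=
  fun k hk => hxy k (hk.trans_le h)

theorem agree_succ_iff : Agree (n + 1) x y ↔ Agree n x y ∧ x n = y n :=
  Nat.forall_lt_succ_right

theorem eq_iff_forall_agree : x = y ↔ ∀ n, Agree n x y :=
  ⟨fun h _ _ _ => h ▸ rfl, fun h => funext fun k => h (k + 1) k k.lt_succ_self⟩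

variable [TopologicalSpace A] [DiscreteTopology A]

theorem isOpen_setOf_agree (n : ℕ) (x : ℕ → A) : IsOpen {y : ℕ → A | Agree n y x} :=
  PiNat.isOpen_cylinder (fun _ => A) x n

theorem exists_forall_agree_mem {U : Set (ℕ → A)} (hU : IsOpen U) (hx : x ∈ U) :
    ∃ n, ∀ y, Agree n y x → y ∈ U := by
  obtain ⟨_, ⟨z, n, rfl⟩, hxz, hzU⟩ :=
    (PiNat.isTopologicalBasis_cylinders fun _ => A).exists_subset_of_mem_open hx hU
  exact ⟨n, fun y hy => hzU (hy.trans hxz)⟩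

theorem dense_iff_forall_exists_agree {Z : Set (ℕ → A)} :
    Dense Z ↔ ∀ n x, ∃ z ∈ Z, Agree n z x := by
  refine ⟨fun hZ n x => ?_, fun hZ => dense_iff_inter_open.2 fun U hU ⟨x, hx⟩ => ?_⟩
  · obtain ⟨z, hzx, hz⟩ := hZ.inter_open_nonempty _ (isOpen_setOf_agree n x) ⟨x, Agree.refl n x⟩
    exact ⟨z, hz, hzx⟩
  · obtain ⟨n, hn⟩ := exists_forall_agree_mem hU hx
    obtain ⟨z, hz, hzx⟩ := hZ n x
    exact ⟨z, hn z hzx, hz⟩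

end Agree

section Baire

theorem isClosed_setOf_injective {ι A : Type*} [TopologicalSpace A] [DiscreteTopology A] :
    IsClosed {g : ι → A | Function.Injective g} := by
  simp only [Function.Injective, Set.ofPred_forall]
  refine isClosed_iInter fun i => isClosed_iInter fun j => ?_
  have hcont : Continuous fun g : ι → A => (g i, g j) := by fun_prop
  exact (isClosed_discrete {p : A × A | p.1 = p.2 → i = j}).preimage hcont

/-- The space of injective maps from `ℕ` to `ℕ`, over which the category quantifiers range. -/
abbrev Inj : Type := {g : ℕ → ℕ // Function.Injective g}

instance : BaireSpace Inj :=
  have : PolishSpace Inj := isClosed_setOf_injective.polishSpace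
  inferInstance

section

variable {X : Type*} [TopologicalSpace X] {U : Set X}

theorem exists_mem_of_eventually_residual [BaireSpace X] (hU : IsOpen U) (hne : U.Nonempty)
    {p : X → Prop} (h : ∀ᶠ x in residual X, x ∈ U → p x) : ∃ x ∈ U, p x := by
  obtain ⟨x, hx, hp⟩ := (dense_of_mem_residual h).inter_open_nonempty U hU hne
  exact ⟨x, hx, hp hx⟩

theorem exists_open_eventually_mem_of_not_eventually_notMem {S : Set X}
    (hS : BaireMeasurableSet S) (hU : IsOpen U)
    (h : ¬ ∀ᶠ x in residual X, x ∈ U → x ∉ S) :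
    ∃ V ⊆ U, IsOpen V ∧ V.Nonempty ∧ ∀ᶠ x in residual X, x ∈ V → x ∈ S := by
  obtain ⟨O, hO, hSO⟩ := hS.residualEq_isOpen
  have hSO : ∀ᶠ x in residual X, x ∈ S ↔ x ∈ O := hSO.mem_iff
  refine ⟨U ∩ O, Set.inter_subset_left, hU.inter hO, ?_, hSO.mono fun x hx hxV => hx.2 hxV.2⟩
  by_contra hempty
  exact h (hSO.mono fun x hx hxU hxS => hempty ⟨x, hxU, hx.1 hxS⟩)

end

theorem isOpen_setOf_inj_agree (n : ℕ) (g : ℕ → ℕ) : IsOpen {h : Inj | Agree n h.1 g} :=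
  (isOpen_setOf_agree n g).preimage continuous_subtype_val

theorem exists_forall_inj_agree_mem {U : Set Inj} (hU : IsOpen U) {g : Inj} (hg : g ∈ U) :
    ∃ n, ∀ h : Inj, Agree n h.1 g.1 → h ∈ U := by
  obtain ⟨V, hV, rfl⟩ := isOpen_induced_iff.1 hU
  obtain ⟨n, hn⟩ := exists_forall_agree_mem hV hg
  exact ⟨n, fun h => hn h.1⟩

theorem exists_inj_agree {n : ℕ} {f : ℕ → ℕ} (hf : Set.InjOn f (Set.Iio n)) :
    ∃ g : Inj, Agree n g.1 f := by
  obtain ⟨e, he⟩ := Cardinal.extend_function_of_lt (s := Set.Iio n)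
    ⟨fun i => f i, fun i j h => Subtype.ext (hf i.2 j.2 h)⟩
    ((Set.finite_Iio n).lt_aleph0.trans_eq Cardinal.mk_nat.symm) ⟨Equiv.refl ℕ⟩
  exact ⟨⟨e, e.injective⟩, fun i hi => he ⟨i, hi⟩⟩

theorem eventually_residual_surjective : ∀ᶠ g in residual Inj, Function.Surjective g.1 := by
  refine eventually_countable_forall.2 fun m => residual_of_dense_open ?_ ?_
  · simp only [Set.ofPred_exists]
    exact isOpen_iUnion fun i => (isOpen_discrete {m}).preimage (f := fun g : Inj => g.1 i)
      ((continuous_apply i).comp continuous_subtype_val)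
  · refine dense_iff_inter_open.2 fun U hU ⟨g, hg⟩ => ?_
    obtain ⟨n, hn⟩ := exists_forall_inj_agree_mem hU hg
    by_cases hm : m ∈ Set.range g.1
    · exact ⟨g, hg, hm⟩
    · refine ⟨⟨Equiv.swap m (g.1 n) ∘ g.1, (Equiv.injective _).comp g.2⟩, hn _ fun i hi => ?_,
        n, Equiv.swap_apply_right m _⟩
      exact Equiv.swap_apply_of_ne_of_ne (fun h => hm ⟨i, h⟩) (g.2.ne hi.ne)

end Baire

section Game

universe u v

variable {L : FirstOrder.Language.{u, v}} {M N : StructureSpace L} {α β : Ordinal.{0}} {n : ℕ}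
  {a b : Fin n → ℕ}

/-- `R x` holds in `M`. Elements of `StructureSpace L` are not found by instance resolution,
whence the explicit structure. -/
abbrev Holds (M : StructureSpace L) {k : ℕ} (R : L.Relations k) (x : Fin k → ℕ) : Prop :=
  @Structure.RelMap L ℕ M k R x

theorem PartialElementary.symm (H : PartialElementary M N a b) : PartialElementary N M b a :=
  fun φ => (H φ).symm

theorem PartialElementary.holds_iff (H : PartialElementary M N a b) {k : ℕ} (R : L.Relations k)
    (x : Fin k → Fin n) : Holds M R (a ∘ x) ↔ Holds N R (b ∘ x) := by
  have := H (R.formula fun i => Term.var (x i))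
  rwa [@Formula.realize_rel L ℕ M, @Formula.realize_rel L ℕ N] at this

theorem PartialElementary.eq_iff (H : PartialElementary M N a b) (i j : Fin n) :
    a i = a j ↔ b i = b j := by
  have := H (Term.equal (Term.var i) (Term.var j))
  rwa [@Formula.realize_equal L ℕ M, @Formula.realize_equal L ℕ N] at this

theorem PlayerTwoWins.partialElementary (H : PlayerTwoWins M N α a b) :
    PartialElementary M N a b := by
  rw [PlayerTwoWins] at H
  exact H.1

theorem PlayerTwoWins.mono (h : β ≤ α) (H : PlayerTwoWins M N α a b) :
    PlayerTwoWins M N β a b := by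
  rw [PlayerTwoWins] at H ⊢
  exact ⟨H.1, fun γ hγ => H.2 γ (hγ.trans_le h)⟩

theorem PlayerTwoWins.symm (H : PlayerTwoWins M N α a b) : PlayerTwoWins N M α b a := by
  induction α using WellFoundedLT.induction generalizing n with
  | _ α ih =>
    rw [PlayerTwoWins] at H ⊢
    exact ⟨H.1.symm, fun β hβ => ⟨fun c => ((H.2 β hβ).2 c).imp fun _ => ih β hβ,
      fun d => ((H.2 β hβ).1 d).imp fun _ => ih β hβ⟩⟩

/-- The initial segment of length `n` of `g`, as a tuple. -/
def res (n : ℕ) (g : ℕ → ℕ) : Fin n → ℕ := fun i => g i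

theorem res_congr {g h : ℕ → ℕ} (H : Agree n g h) : res n g = res n h :=
  funext fun i => H i i.2

theorem snoc_res (n : ℕ) (g : ℕ → ℕ) (c : ℕ) :
    (Fin.snoc (res n g) c : Fin (n + 1) → ℕ) = res (n + 1) (Function.update g n c) := by
  funext i
  refine Fin.lastCases ?_ (fun i => ?_) i
  · simp [res]
  · simp [res, i.2.ne]

theorem PlayerTwoWins.exists_agree_of_add_natCast (k : ℕ) {g g' : ℕ → ℕ}
    (H : PlayerTwoWins M N (α + k) (res n g) (res n g')) {c' : ℕ → ℕ} (hc' : Agree n c' g') :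
    ∃ c, Agree n c g ∧ PlayerTwoWins M N α (res (n + k) c) (res (n + k) c') := by
  induction k generalizing α with
  | zero => exact ⟨g, Agree.refl n g, by simpa [res_congr hc'] using H⟩
  | succ k ih =>
    have hclock : α + (k + 1 : ℕ) = α + 1 + k := by
      rw [Nat.add_comm k 1, Nat.cast_add, Nat.cast_one, add_assoc]
    obtain ⟨c, hc, hw⟩ := ih (hclock ▸ H)
    rw [PlayerTwoWins] at hw
    obtain ⟨d, hd⟩ := (hw.2 α (lt_add_one α)).2 (c' (n + k))
    rw [snoc_res, snoc_res, Function.update_eq_self] at hd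
    refine ⟨_, fun i hi => ?_, hd⟩
    rw [Function.update_of_ne (by omega), hc i hi]

theorem PlayerTwoWins.exists_inj_agree {m : ℕ} (hnm : n ≤ m) {g g' : ℕ → ℕ}
    (H : PlayerTwoWins M N (α + ω) (res n g) (res n g')) {c' : Inj} (hc' : Agree n c'.1 g') :
    ∃ c : Inj, Agree n c.1 g ∧ PlayerTwoWins M N α (res m c.1) (res m c'.1) := by
  obtain ⟨k, rfl⟩ := Nat.exists_eq_add_of_le hnm
  obtain ⟨c, hc, hw⟩ :=
    (H.mono (by gcongr; exact (natCast_lt_omega0 k).le)).exists_agree_of_add_natCast k hc'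
  have hinj : Set.InjOn c (Set.Iio (n + k)) := fun i hi j hj hij =>
    c'.2 ((hw.partialElementary.eq_iff ⟨i, hi⟩ ⟨j, hj⟩).1 hij)
  obtain ⟨d, hd⟩ := CountableModels.exists_inj_agree hinj
  exact ⟨d, (hd.mono hnm).trans hc, by rwa [res_congr hd]⟩

end Game

section Vaught

universe u v w

variable {L : FirstOrder.Language.{u, v}} {M N K : StructureSpace L}

theorem Iso.symm : Iso M N → Iso N M :=
  fun ⟨e⟩ => ⟨@FirstOrder.Language.Equiv.symm L ℕ ℕ M N e⟩

theorem Iso.trans : Iso M N → Iso N K → Iso M K :=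
  fun ⟨e⟩ ⟨f⟩ => ⟨@FirstOrder.Language.Equiv.comp L ℕ ℕ M N ℕ K f e⟩

theorem Iso.mem_modelSpace {T : L.Theory} (h : Iso M N) (hM : M ∈ ModelSpace T) :
    N ∈ ModelSpace T := by
  obtain ⟨e⟩ := h
  exact @StrongHomClass.theory_model L ℕ ℕ M N T _
    (@FirstOrder.Language.Equiv.instEquivLike L ℕ ℕ M N)
    (@FirstOrder.Language.Equiv.instStrongHomClass L ℕ ℕ M N) e hM

theorem IsomorphismIsBorel.exists_borel {T : L.Theory} (hT : IsomorphismIsBorel T) :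
    ∃ A, MeasurableSet[borel (StructureSpace L × StructureSpace L)] A ∧
      ∀ M ∈ ModelSpace T, ∀ N ∈ ModelSpace T, (M, N) ∈ A ↔ Iso M N := by
  have hind : IsInducing (Prod.map Subtype.val Subtype.val :
      ModelSpace T × ModelSpace T → StructureSpace L × StructureSpace L) :=
    IsInducing.subtypeVal.prodMap IsInducing.subtypeVal
  rw [IsomorphismIsBorel, hind.eq_induced, borel_comap] at hT
  obtain ⟨A, hA, hAT⟩ := hT
  exact ⟨A, hA, fun M hM N hN => Set.ext_iff.1 hAT (⟨M, hM⟩, ⟨N, hN⟩)⟩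

variable [L.IsRelational]

/-- The pullback of `N` along `g`: the structure for which `g` preserves and reflects every
relation. -/
def pull (g : ℕ → ℕ) (N : StructureSpace L) : StructureSpace L where
  funMap := fun f _ => isEmptyElim f
  RelMap := fun R x => Holds N R (g ∘ x)

theorem iso_pull {g : ℕ → ℕ} (hg : Function.Bijective g) (N : StructureSpace L) :
    Iso (pull g N) N :=
  ⟨@FirstOrder.Language.Equiv.mk L ℕ ℕ (pull g N) N (Equiv.ofBijective g hg)
    (fun f _ => isEmptyElim f) fun _ _ => Iff.rfl⟩

variable {X : Type w} {A : Set (X × StructureSpace L)}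

/-- The Vaught transform of `A`: for comeagerly many injective extensions `h` of the initial
segment of length `n` of `g`, the pair of `x` and `pull h N` belongs to `A`. -/
def Generic (A : Set (X × StructureSpace L)) (x : X) (N : StructureSpace L) (n : ℕ)
    (g : Inj) : Prop :=
  ∀ᶠ h in residual Inj, Agree n h.1 g.1 → (x, pull h.1 N) ∈ A

theorem exists_mem_of_eventually_residual_agree {n : ℕ} {g : Inj} {p : Inj → Prop}
    (h : ∀ᶠ h in residual Inj, Agree n h.1 g.1 → p h) : ∃ h : Inj, Agree n h.1 g.1 ∧ p h :=
  exists_mem_of_eventually_residual (isOpen_setOf_inj_agree n g.1) ⟨g, Agree.refl n g.1⟩ h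

/-- Player II's winning a game of some fixed countable length transfers the Vaught transforms of
`A` from one structure to the other. -/
structure VaughtInvariant (A : Set (X × StructureSpace L)) : Prop where
  baireMeasurableSet (x : X) (N : StructureSpace L) :
    BaireMeasurableSet {h : Inj | (x, pull h.1 N) ∈ A}
  exists_level : ∃ α < ω_ 1, ∀ x N N' n (g g' : Inj),
    PlayerTwoWins N N' α (res n g.1) (res n g'.1) → Generic A x N n g → Generic A x N' n g'

theorem vaughtInvariant_preimage_fst (S : Set X) :
    VaughtInvariant (Prod.fst ⁻¹' S : Set (X × StructureSpace L)) where
  baireMeasurableSet x N := by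
    by_cases hx : x ∈ S
    · simpa [hx] using isOpen_univ.baireMeasurableSet
    · simpa [hx] using isOpen_empty.baireMeasurableSet
  exists_level := ⟨0, omega_pos 1, fun x N N' n g g' _ hg => Eventually.of_forall fun _ _ =>
    (exists_mem_of_eventually_residual_agree hg).choose_spec.2⟩

theorem exists_res_comp_eq (n : ℕ) {k : ℕ} (x : Fin k → ℕ) :
    ∃ m, n ≤ m ∧ ∃ y : Fin k → Fin m, ∀ g : ℕ → ℕ, g ∘ x = res m g ∘ y := by
  have hlt (i : Fin k) : x i < max n (∑ i, x i + 1) :=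
    lt_max_of_lt_right (Nat.lt_succ_of_le (Finset.single_le_sum (by simp) (Finset.mem_univ i)))
  exact ⟨_, le_max_left _ _, fun i => ⟨x i, hlt i⟩, fun g => rfl⟩

theorem vaughtInvariant_setOf_holds {k : ℕ} (R : L.Relations k) (x : Fin k → ℕ) :
    VaughtInvariant {p : X × StructureSpace L | Holds p.2 R x} where
  baireMeasurableSet _ N := by
    have hcont : Continuous fun h : Inj => h.1 ∘ x :=
      continuous_pi fun i => (continuous_apply (x i)).comp continuous_subtype_val
    exact ((isOpen_discrete {y : Fin k → ℕ | Holds N R y}).preimage hcont).baireMeasurableSet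
  exists_level := by
    refine ⟨ω, omega0_lt_omega_one, fun _ N N' n g g' hw hg => Eventually.of_forall ?_⟩
    intro c' hc'
    obtain ⟨m, hnm, y, hy⟩ := exists_res_comp_eq n x
    obtain ⟨c, hc, hcw⟩ := PlayerTwoWins.exists_inj_agree (α := 0) hnm (by rwa [zero_add]) hc'
    obtain ⟨h, hhc, hR⟩ := exists_mem_of_eventually_residual_agree (g := c) (n := m) <|
      hg.mono fun h hh hhc => hh ((hhc.mono hnm).trans hc)
    have hiff := hcw.partialElementary.holds_iff R y
    rw [← res_congr hhc, ← hy, ← hy] at hiff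
    exact hiff.1 hR

theorem VaughtInvariant.compl (hA : VaughtInvariant A) : VaughtInvariant Aᶜ where
  baireMeasurableSet x N := (hA.baireMeasurableSet x N).compl
  exists_level := by
    obtain ⟨α, hα, H⟩ := hA.exists_level
    refine ⟨α + ω, isPrincipal_add_omega 1 hα omega0_lt_omega_one, ?_⟩
    intro x N N' n g g' hw hg
    by_contra hg'
    obtain ⟨V, hVg', hV, ⟨c', hc'⟩, hVA⟩ := exists_open_eventually_mem_of_not_eventually_notMem
      (hA.baireMeasurableSet x N') (isOpen_setOf_inj_agree n g'.1) hg'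
    obtain ⟨m, hm⟩ := exists_forall_inj_agree_mem hV hc'
    obtain ⟨c, hc, hcw⟩ := hw.exists_inj_agree (le_max_left n m) (hVg' hc')
    have hcA' : Generic A x N' (max n m) c' :=
      hVA.mono fun h hhA hhc' => hhA (hm h (hhc'.mono (le_max_right n m)))
    have hcA : Generic A x N (max n m) c := H x N' N _ c' c hcw.symm hcA'
    obtain ⟨h, -, hhA, hhA'⟩ := exists_mem_of_eventually_residual_agree (g := c) (n := max n m)
      (p := fun h => (x, pull h.1 N) ∈ A ∧ (x, pull h.1 N) ∉ A) <| by
        filter_upwards [hcA, hg] with h hhA hhA' hhc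
        exact ⟨hhA hhc, hhA' ((hhc.mono (le_max_left n m)).trans hc)⟩
    exact hhA' hhA

theorem generic_iInter_iff {A : ℕ → Set (X × StructureSpace L)} {x : X} {N : StructureSpace L}
    {n : ℕ} {g : Inj} : Generic (⋂ i, A i) x N n g ↔ ∀ i, Generic (A i) x N n g := by
  simp only [Generic, Set.mem_iInter, ← eventually_countable_forall]
  exact eventually_congr (Eventually.of_forall fun h => forall_comm)

theorem VaughtInvariant.iInter {A : ℕ → Set (X × StructureSpace L)}
    (hA : ∀ i, VaughtInvariant (A i)) : VaughtInvariant (⋂ i, A i) where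
  baireMeasurableSet x N := by
    simp only [Set.mem_iInter, Set.ofPred_forall]
    exact BaireMeasurableSet.iInter fun i => (hA i).baireMeasurableSet x N
  exists_level := by
    choose α hα H using fun i => (hA i).exists_level
    refine ⟨⨆ i, α i, Ordinal.iSup_lt_omega_one hα, fun x N N' n g g' hw hg => ?_⟩
    rw [generic_iInter_iff] at hg ⊢
    exact fun i => H i x N N' n g g' (hw.mono (Ordinal.le_iSup _ i)) (hg i)

theorem VaughtInvariant.iUnion {A : ℕ → Set (X × StructureSpace L)}
    (hA : ∀ i, VaughtInvariant (A i)) : VaughtInvariant (⋃ i, A i) := by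
  simpa [Set.compl_iInter] using (VaughtInvariant.iInter fun i => (hA i).compl).compl

/-- The σ-algebra of Vaught-invariant sets. -/
@[reducible] def vaughtInvariantSpace (X : Type w) (L : FirstOrder.Language.{u, v})
    [L.IsRelational] : MeasurableSpace (X × StructureSpace L) where
  MeasurableSet' A := VaughtInvariant A
  measurableSet_empty := vaughtInvariant_preimage_fst ∅
  measurableSet_compl _ := VaughtInvariant.compl
  measurableSet_iUnion _ := VaughtInvariant.iUnion

/-- The sets of structures given by a single atomic fact; these and their complements form a
subbasis of the logic topology of a relational language. -/
def atomicSets (L : FirstOrder.Language.{u, v}) : Set (Set (StructureSpace L)) :=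
  Set.range fun q : Σ k, L.Relations k × (Fin k → ℕ) => {M | Holds M q.2.1 q.2.2}

theorem logicTopology_eq_generateFrom : (inferInstance : TopologicalSpace (StructureSpace L)) =
    TopologicalSpace.generateFrom (atomicSets L ∪ compl '' atomicSets L) := by
  refine congrArg TopologicalSpace.generateFrom (Set.ext fun U => ?_)
  simp only [atomicSets, ← Set.range_comp, Set.mem_union, Set.mem_ofPred_eq, Set.mem_range,
    Sigma.exists, Prod.exists, eq_comm (a := U)]
  exact ⟨fun h => h.resolve_right fun ⟨_, f, _⟩ => isEmptyElim f, Or.inl⟩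

variable [∀ k, Countable (L.Relations k)]

instance : SecondCountableTopology (StructureSpace L) :=
  ⟨_, (Set.countable_range _).union ((Set.countable_range _).image _),
    logicTopology_eq_generateFrom⟩

theorem vaughtInvariant_of_measurableSet_borel [TopologicalSpace X]
    (hA : MeasurableSet[borel (X × StructureSpace L)] A) : VaughtInvariant A := by
  borelize X (StructureSpace L)
  have hborel : borel (X × StructureSpace L) ≤ Prod.instMeasurableSpace :=
    OpensMeasurableSpace.borel_le
  have hfst : MeasurableSpace.comap Prod.fst (borel X) ≤ vaughtInvariantSpace X L := by
    rintro _ ⟨S, -, rfl⟩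
    exact vaughtInvariant_preimage_fst S
  have hsnd : MeasurableSpace.comap Prod.snd (borel (StructureSpace L)) ≤
      vaughtInvariantSpace X L := by
    rw [borel_eq_generateFrom_of_subbasis logicTopology_eq_generateFrom,
      MeasurableSpace.comap_generateFrom]
    refine MeasurableSpace.generateFrom_le ?_
    rintro _ ⟨_, ⟨q, rfl⟩ | ⟨_, ⟨q, rfl⟩, rfl⟩, rfl⟩
    · exact vaughtInvariant_setOf_holds q.2.1 q.2.2
    · exact (vaughtInvariant_setOf_holds q.2.1 q.2.2).compl
  exact hborel.trans (sup_le hfst hsnd) A hA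

theorem IsomorphismIsBorel.exists_level {T : L.Theory} (hT : IsomorphismIsBorel T) :
    ∃ α < ω_ 1, ∀ M ∈ ModelSpace T, ∀ N ∈ ModelSpace T, EquivUpTo α M N → Iso M N := by
  obtain ⟨A, hA, hAT⟩ := hT.exists_borel
  obtain ⟨α, hα, H⟩ := (vaughtInvariant_of_measurableSet_borel hA).exists_level
  refine ⟨α, hα, fun M hM N hN hMN => ?_⟩
  let g : Inj := ⟨id, Function.injective_id⟩
  have hMM : Generic A M M 0 g := by
    filter_upwards [eventually_residual_surjective] with h hsurj _
    have hpull := (iso_pull ⟨h.2, hsurj⟩ M).symm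
    exact (hAT M hM _ (hpull.mem_modelSpace hM)).2 hpull
  have hwin : PlayerTwoWins M N α (res 0 g.1) (res 0 g.1) := by
    rwa [Subsingleton.elim (res 0 g.1) Fin.elim0]
  obtain ⟨h, -, hsurj, hMN⟩ := exists_mem_of_eventually_residual_agree (g := g) (n := 0)
    (p := fun h => Function.Surjective h.1 ∧ (M, pull h.1 N) ∈ A) <| by
      filter_upwards [H M M N 0 g g hwin hMM, eventually_residual_surjective] with h hh hsurj h0
      exact ⟨hsurj, hh h0⟩
  have hpull := iso_pull ⟨h.2, hsurj⟩ N
  exact ((hAT M hM _ (hpull.symm.mem_modelSpace hN)).1 hMN).trans hpull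

end Vaught

end CountableModels

namespace RefBin

open FirstOrder FirstOrder.Language Topology Filter Ordinal CountableModels

section Branch

/-- The branches of the full binary tree. -/
abbrev Branch : Type := ℕ → Bool

/-- The branch with first bit `i` and remainder `w`. -/
def cons (i : Bool) (w : Branch) : Branch
  | 0 => i
  | k + 1 => w k

/-- The branch `x` without its first bit. -/
def tail (x : Branch) : Branch := fun k => x (k + 1)

/-- The branch `x` without its first `n` bits. -/
def drop (n : ℕ) (x : Branch) : Branch := fun k => x (k + n)

/-- The branch that follows `x` up to level `n`, turns away from `x` there, and continues with
`w`. -/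
def turn (x : Branch) : ℕ → Branch → Branch
  | 0, w => cons (!x 0) w
  | n + 1, w => cons (x 0) (turn (tail x) n w)

variable {n : ℕ} {x y : Branch}

@[simp] theorem cons_head_tail (x : Branch) : cons (x 0) (tail x) = x := by
  funext k
  cases k <;> rfl

theorem exists_eq_cons_cons (x : Branch) : ∃ i j w, x = cons i (cons j w) :=
  ⟨x 0, x 1, tail (tail x), by rw [← cons_head_tail x, ← cons_head_tail (tail x)]; rfl⟩

theorem agree_succ_iff_tail : Agree (n + 1) x y ↔ x 0 = y 0 ∧ Agree n (tail x) (tail y) :=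
  ⟨fun h => ⟨h 0 n.succ_pos, fun k hk => h (k + 1) (Nat.succ_lt_succ hk)⟩, fun h k hk => by
    cases k with
    | zero => exact h.1
    | succ k => exact h.2 k (Nat.lt_of_succ_lt_succ hk)⟩

theorem agree_cons_iff {i j : Bool} :
    Agree (n + 1) (cons i x) (cons j y) ↔ i = j ∧ Agree n x y :=
  agree_succ_iff_tail

theorem dense_preimage_cons {Z : Set Branch} (hZ : Dense Z) (i : Bool) : Dense (cons i ⁻¹' Z) := by
  refine dense_iff_forall_exists_agree.2 fun n x => ?_
  obtain ⟨z, hz, hag⟩ := dense_iff_forall_exists_agree.1 hZ (n + 1) (cons i x)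
  obtain ⟨rfl, hag⟩ := agree_succ_iff_tail.1 hag
  exact ⟨tail z, by simpa using hz, hag⟩

theorem countable_preimage_tail {S : Set Branch} (hS : S.Countable) : (tail ⁻¹' S).Countable := by
  refine (Set.countable_iUnion fun i => hS.image (cons i)).mono fun x hx => ?_
  exact Set.mem_iUnion.2 ⟨x 0, tail x, hx, cons_head_tail x⟩

theorem countable_preimage_drop {S : Set Branch} (hS : S.Countable) (n : ℕ) :
    (drop n ⁻¹' S).Countable := by
  induction n with
  | zero => exact hS
  | succ n ih => exact countable_preimage_tail ih

/-- The branches that are eventually constant with value `i`. -/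
def eventuallyConst (i : Bool) : Set Branch := {z | ∀ᶠ k in atTop, z k = i}

theorem countable_eventuallyConst (i : Bool) : (eventuallyConst i).Countable := by
  refine (Set.countable_iUnion fun n =>
    countable_preimage_drop (Set.countable_singleton fun _ => i) n).mono fun z hz => ?_
  obtain ⟨n, hn⟩ := eventually_atTop.1 hz
  exact Set.mem_iUnion.2 ⟨n, funext fun k => hn _ (Nat.le_add_left n k)⟩

theorem dense_eventuallyConst (i : Bool) : Dense (eventuallyConst i) := by
  refine dense_iff_forall_exists_agree.2 fun n x => ⟨fun k => if k < n then x k else i, ?_, ?_⟩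
  · exact (eventually_ge_atTop n).mono fun _ hk => if_neg hk.not_gt
  · exact fun _ hk => if_pos hk

end Branch

section Sim

/-- A coloured tree `m` is a set of branches with multiplicities, the branch `x` being present if
`m x ≠ 0`. -/
abbrev ColouredTree : Type := Branch → ℕ

/-- The coloured tree whose two halves are `f false` and `f true`. -/
def join (f : Bool → ColouredTree) : ColouredTree := fun x => f (x 0) (tail x)

/-- The coloured tree with left half `A` and right half `P`, thought of as `A` with `P` hung beside
its root. -/
def hang (A P : ColouredTree) : ColouredTree := join fun j => if j then P else A

/-- The part of the coloured tree `m` that leaves the branch `x` at level `n`. -/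
def sib (m : ColouredTree) (x : Branch) (n : ℕ) : ColouredTree := fun w => m (turn x n w)

/-- The back-and-forth equivalence of coloured trees at level `α`: Player II answers a branch by a
branch of the same multiplicity in such a way that the parts that leave the two branches at any
given level are equivalent at the next clock value `β < α`. -/
def Sim (α : Ordinal.{0}) (m m' : ColouredTree) : Prop :=
  ∀ β : Ordinal.{0}, β < α →
    (∀ x, m x ≠ 0 → ∃ y, m' y = m x ∧ ∀ n, Sim β (sib m x n) (sib m' y n)) ∧
    (∀ y, m' y ≠ 0 → ∃ x, m x = m' y ∧ ∀ n, Sim β (sib m x n) (sib m' y n))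
termination_by α

variable {α β γ : Ordinal.{0}} {m m' : ColouredTree}

theorem Sim.mono (h : β ≤ α) (H : Sim α m m') : Sim β m m' := by
  rw [Sim] at H ⊢
  exact fun γ hγ => H γ (hγ.trans_le h)

theorem Sim.refl (α : Ordinal.{0}) (m : ColouredTree) : Sim α m m := by
  induction α using WellFoundedLT.induction generalizing m with
  | _ α ih =>
    rw [Sim]
    exact fun β hβ => ⟨fun x _ => ⟨x, rfl, fun _ => ih β hβ _⟩,
      fun x _ => ⟨x, rfl, fun _ => ih β hβ _⟩⟩

theorem Sim.symm (H : Sim α m m') : Sim α m' m := by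
  induction α using WellFoundedLT.induction generalizing m m' with
  | _ α ih =>
    rw [Sim] at H ⊢
    exact fun β hβ =>
      ⟨fun x hx => ((H β hβ).2 x hx).imp fun _ h => ⟨h.1, fun n => ih β hβ (h.2 n)⟩,
        fun x hx => ((H β hβ).1 x hx).imp fun _ h => ⟨h.1, fun n => ih β hβ (h.2 n)⟩⟩

theorem Sim.join_forth (hβ : β < α) {f f' : Bool → ColouredTree} (H : ∀ i, Sim α (f i) (f' i))
    (x : Branch) (hx : join f x ≠ 0) :
    ∃ y, join f' y = join f x ∧ ∀ n, Sim β (sib (join f) x n) (sib (join f') y n) := by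
  have h := H (x 0)
  rw [Sim] at h
  obtain ⟨y, hy, hsib⟩ := (h β hβ).1 (tail x) hx
  refine ⟨cons (x 0) y, hy, fun n => ?_⟩
  cases n with
  | zero => exact (H _).mono hβ.le
  | succ n => exact hsib n

theorem Sim.join {f f' : Bool → ColouredTree} (H : ∀ i, Sim α (f i) (f' i)) :
    Sim α (join f) (join f') := by
  rw [Sim]
  exact fun β hβ => ⟨Sim.join_forth hβ H, fun y hy =>
    (Sim.join_forth hβ (fun i => (H i).symm) y hy).imp fun _ h => ⟨h.1, fun n => (h.2 n).symm⟩⟩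

theorem Sim.hang {A A' P P' : ColouredTree} (hA : Sim α A A') (hP : Sim α P P') :
    Sim α (hang A P) (hang A' P') :=
  Sim.join (Bool.forall_bool.2 ⟨hA, hP⟩)

end Sim

section Ramify

variable {α γ : Ordinal.{0}} {Z Z' : Set Branch} {W : ℕ → Bool → ColouredTree}

/-- The full binary tree with the coloured tree `W n i` hung beside the `n`-th edge of a branch if
this edge is labelled `i`; a branch of the full binary tree itself is present, with
multiplicity 2, if it belongs to `Z`. Its edge labels are the bits in the even positions, and the
first `true` in an odd position leads into the coloured tree that hangs there. -/
noncomputable def ramify (Z : Set Branch) (W : ℕ → Bool → ColouredTree) : ColouredTree := fun x =>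
  open Classical in
  if h : ∃ n, x (2 * n + 1) = true then
    W (Nat.find h) (x (2 * Nat.find h)) (drop (2 * Nat.find h + 2) x)
  else Z.indicator (fun _ => 2) fun k => x (2 * k)

/-- The branch of `ramify Z W` that corresponds to the branch `z` of the full binary tree. -/
def spine (z : Branch) : Branch := fun k => if k % 2 = 0 then z (k / 2) else false

theorem ramify_cons_true (Z : Set Branch) (W : ℕ → Bool → ColouredTree) (i : Bool) (w : Branch) :
    ramify Z W (cons i (cons true w)) = W 0 i w := by
  have h : ∃ n, cons i (cons true w) (2 * n + 1) = true := ⟨0, rfl⟩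
  have hfind : Nat.find h = 0 := (Nat.find_eq_zero h).2 rfl
  rw [ramify, dif_pos h, hfind]
  rfl

theorem ramify_cons_false (Z : Set Branch) (W : ℕ → Bool → ColouredTree) (i : Bool) (w : Branch) :
    ramify Z W (cons i (cons false w)) = ramify (cons i ⁻¹' Z) (fun n => W (n + 1)) w := by
  by_cases h : ∃ n, w (2 * n + 1) = true
  · have h' : ∃ n, cons i (cons false w) (2 * n + 1) = true := h.imp' (· + 1) fun _ => id
    have hfind : Nat.find h' = Nat.find h + 1 := Nat.find_comp_succ h' h Bool.false_ne_true
    rw [ramify, dif_pos h', hfind, ramify, dif_pos h]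
    rfl
  · have h' : ¬ ∃ n, cons i (cons false w) (2 * n + 1) = true := by
      rintro ⟨_ | n, hn⟩
      exacts [Bool.false_ne_true hn, h ⟨n, hn⟩]
    have heven : (fun k => cons i (cons false w) (2 * k)) = cons i fun k => w (2 * k) := by
      funext k
      cases k <;> rfl
    rw [ramify, dif_neg h', heven, ramify, dif_neg h]
    rfl

theorem ramify_eq_join_hang (Z : Set Branch) (W : ℕ → Bool → ColouredTree) :
    ramify Z W = join fun i => hang (ramify (cons i ⁻¹' Z) fun n => W (n + 1)) (W 0 i) := by
  funext x
  obtain ⟨i, _ | _, w, rfl⟩ := exists_eq_cons_cons x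
  · exact ramify_cons_false Z W _ _
  · exact ramify_cons_true Z W _ _

theorem spine_eq_cons (z : Branch) : spine z = cons (z 0) (cons false (spine (tail z))) := by
  funext k
  match k with
  | 0 => rfl
  | 1 => rfl
  | k + 2 => simp [spine, cons, tail, Nat.add_div_right]

theorem ramify_spine (Z : Set Branch) (W : ℕ → Bool → ColouredTree) (z : Branch) :
    ramify Z W (spine z) = Z.indicator (fun _ => 2) z := by
  have h : ¬ ∃ n, spine z (2 * n + 1) = true := by
    rintro ⟨n, hn⟩
    simp [spine] at hn
  have heven : (fun k => spine z (2 * k)) = z := by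
    funext k
    simp [spine]
  rw [ramify, dif_neg h, heven]

theorem ramify_eq_of_exists {x : Branch} (h : ∃ n, x (2 * n + 1) = true) (Z Z' : Set Branch)
    (W : ℕ → Bool → ColouredTree) : ramify Z W x = ramify Z' W x := by
  rw [ramify, ramify, dif_pos h, dif_pos h]

theorem exists_eq_spine_or (x : Branch) : (∃ z, x = spine z) ∨ ∃ n, x (2 * n + 1) = true := by
  refine or_iff_not_imp_right.2 fun h => ⟨fun k => x (2 * k), funext fun k => ?_⟩
  rcases Nat.even_or_odd' k with ⟨n, rfl | rfl⟩
  · simp [spine]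
  · simpa [spine, Nat.mul_add_mod] using fun hn => h ⟨n, hn⟩

theorem mem_of_ramify_spine_ne_zero {z : Branch} (h : ramify Z W (spine z) ≠ 0) : z ∈ Z :=
  Set.mem_of_indicator_ne_zero (ramify_spine Z W z ▸ h)

theorem exists_ramify_eq_two (hZ : Z.Nonempty) : ∃ x, ramify Z W x = 2 :=
  hZ.imp' spine fun z hz => by rw [ramify_spine, Set.indicator_of_mem hz]

section Siblings

variable (Z : Set Branch) (W : ℕ → Bool → ColouredTree) (i : Bool) (w : Branch)

theorem sib_ramify_zero (x : Branch) :
    sib (ramify Z W) x 0 =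
      hang (ramify (cons (!x 0) ⁻¹' Z) fun n => W (n + 1)) (W 0 (!x 0)) := by
  rw [ramify_eq_join_hang]
  rfl

theorem sib_ramify_cons_false_one : sib (ramify Z W) (cons i (cons false w)) 1 = W 0 i := by
  rw [ramify_eq_join_hang]
  rfl

theorem sib_ramify_cons_true_one :
    sib (ramify Z W) (cons i (cons true w)) 1 = ramify (cons i ⁻¹' Z) fun n => W (n + 1) := by
  rw [ramify_eq_join_hang]
  rfl

theorem sib_ramify_cons_false_add_two (k : ℕ) :
    sib (ramify Z W) (cons i (cons false w)) (k + 2) =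
      sib (ramify (cons i ⁻¹' Z) fun n => W (n + 1)) w k := by
  rw [ramify_eq_join_hang]
  rfl

theorem sib_ramify_cons_true_add_two (k : ℕ) :
    sib (ramify Z W) (cons i (cons true w)) (k + 2) = sib (W 0 i) w k := by
  rw [ramify_eq_join_hang]
  rfl

end Siblings

/-- The two trees that hang beside an `n`-th edge, according to its label, cannot be told apart at a
level below `α` as soon as `n` is large. -/
def LabelsMerge (α : Ordinal.{0}) (W : ℕ → Bool → ColouredTree) : Prop :=
  ∀ γ < α, ∀ᶠ n in atTop, ∀ i i', Sim γ (W n i) (W n i')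

theorem LabelsMerge.mono (h : γ ≤ α) (hW : LabelsMerge α W) : LabelsMerge γ W :=
  fun δ hδ => hW δ (hδ.trans_le h)

theorem LabelsMerge.shift (hW : LabelsMerge α W) : LabelsMerge α fun n => W (n + 1) :=
  fun γ hγ => (tendsto_add_atTop_nat 1).eventually (hW γ hγ)

theorem sim_sib_ramify
    (H : ∀ W, LabelsMerge γ W → ∀ Z Z', Dense Z → Dense Z' → Sim γ (ramify Z W) (ramify Z' W))
    (hW : LabelsMerge γ W) (hZ : Dense Z) (hZ' : Dense Z') (x : Branch) (k : ℕ) :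
    Sim γ (sib (ramify Z W) x k) (sib (ramify Z' W) x k) := by
  induction k using Nat.twoStepInduction generalizing W Z Z' x with
  | zero =>
    rw [sib_ramify_zero, sib_ramify_zero]
    exact (H _ hW.shift _ _ (dense_preimage_cons hZ _) (dense_preimage_cons hZ' _)).hang
      (Sim.refl γ _)
  | one =>
    obtain ⟨i, _ | _, w, rfl⟩ := exists_eq_cons_cons x
    · rw [sib_ramify_cons_false_one, sib_ramify_cons_false_one]
      exact Sim.refl γ _
    · rw [sib_ramify_cons_true_one, sib_ramify_cons_true_one]
      exact H _ hW.shift _ _ (dense_preimage_cons hZ i) (dense_preimage_cons hZ' i)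
  | more k ih _ =>
    obtain ⟨i, _ | _, w, rfl⟩ := exists_eq_cons_cons x
    · rw [sib_ramify_cons_false_add_two, sib_ramify_cons_false_add_two]
      exact ih hW.shift (dense_preimage_cons hZ i) (dense_preimage_cons hZ' i) w
    · rw [sib_ramify_cons_true_add_two, sib_ramify_cons_true_add_two]
      exact Sim.refl γ _

theorem sim_sib_spine
    (H : ∀ W, LabelsMerge γ W → ∀ Z Z', Dense Z → Dense Z' → Sim γ (ramify Z W) (ramify Z' W))
    (hW : LabelsMerge γ W) (hZ : Dense Z) (hZ' : Dense Z') {z z' : Branch}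
    (hz : ∀ n, Sim γ (W n (z n)) (W n (z' n)) ∧ Sim γ (W n (!z n)) (W n (!z' n))) (k : ℕ) :
    Sim γ (sib (ramify Z W) (spine z) k) (sib (ramify Z' W) (spine z') k) := by
  induction k using Nat.twoStepInduction generalizing W Z Z' z z' with
  | zero =>
    rw [sib_ramify_zero, sib_ramify_zero]
    exact (H _ hW.shift _ _ (dense_preimage_cons hZ _) (dense_preimage_cons hZ' _)).hang (hz 0).2
  | one =>
    rw [spine_eq_cons z, spine_eq_cons z', sib_ramify_cons_false_one, sib_ramify_cons_false_one]
    exact (hz 0).1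
  | more k ih _ =>
    rw [spine_eq_cons z, spine_eq_cons z', sib_ramify_cons_false_add_two,
      sib_ramify_cons_false_add_two]
    exact ih hW.shift (dense_preimage_cons hZ _) (dense_preimage_cons hZ' _) fun n => hz (n + 1)

theorem sim_ramify_forth
    (H : ∀ W, LabelsMerge γ W → ∀ Z Z', Dense Z → Dense Z' → Sim γ (ramify Z W) (ramify Z' W))
    (hγ : γ < α) (hW : LabelsMerge α W) (hZ : Dense Z) (hZ' : Dense Z') (x : Branch)
    (hx : ramify Z W x ≠ 0) :
    ∃ y, ramify Z' W y = ramify Z W x ∧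
      ∀ n, Sim γ (sib (ramify Z W) x n) (sib (ramify Z' W) y n) := by
  rcases exists_eq_spine_or x with ⟨z, rfl⟩ | h
  · obtain ⟨N, hN⟩ := eventually_atTop.1 (hW γ hγ)
    obtain ⟨z', hz', hag⟩ := dense_iff_forall_exists_agree.1 hZ' N z
    refine ⟨spine z', ?_, sim_sib_spine H (hW.mono hγ.le) hZ hZ' fun n => ?_⟩
    · rw [ramify_spine, ramify_spine, Set.indicator_of_mem hz',
        Set.indicator_of_mem (mem_of_ramify_spine_ne_zero hx)]
    · rcases lt_or_ge n N with hn | hn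
      · rw [hag n hn]
        exact ⟨Sim.refl γ _, Sim.refl γ _⟩
      · exact ⟨hN n hn _ _, hN n hn _ _⟩
  · exact ⟨x, ramify_eq_of_exists h _ _ _, sim_sib_ramify H (hW.mono hγ.le) hZ hZ' x⟩

theorem sim_ramify (hW : LabelsMerge α W) (hZ : Dense Z) (hZ' : Dense Z') :
    Sim α (ramify Z W) (ramify Z' W) := by
  induction α using WellFoundedLT.induction generalizing W Z Z' with
  | _ α ih =>
    have forth {γ Z Z'} (hγ : γ < α) (hZ : Dense Z) (hZ' : Dense Z') :=
      sim_ramify_forth (fun W hW Z Z' hZ hZ' => ih γ hγ hW hZ hZ') hγ hW hZ hZ'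
    rw [Sim]
    exact fun γ hγ => ⟨forth hγ hZ hZ', fun y hy =>
      (forth hγ hZ' hZ y hy).imp fun _ h => ⟨h.1, fun n => (h.2 n).symm⟩⟩

end Ramify

section Embedding

/-- An embedding of coloured trees: an isometric map of branches that preserves multiplicities. -/
structure TreeEmbedding (m m' : ColouredTree) where
  toFun : Branch → Branch
  agree_map_iff : ∀ n x y, Agree n (toFun x) (toFun y) ↔ Agree n x y
  mult_map : ∀ x, m' (toFun x) = m x

instance (m m' : ColouredTree) : CoeFun (TreeEmbedding m m') fun _ => Branch → Branch :=
  ⟨TreeEmbedding.toFun⟩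

namespace TreeEmbedding

variable {m m' A A' P P' : ColouredTree}

theorem isEmpty_of_mult {c : ℕ} (hm : ∃ x, m x = c) (hm' : ∀ x, m' x ≠ c) :
    IsEmpty (TreeEmbedding m m') :=
  ⟨fun φ => hm.elim fun x hx => hm' (φ x) ((φ.mult_map x).trans hx)⟩

theorem exists_apply_zero_eq_xor (φ : TreeEmbedding m m') : ∃ b, ∀ x, φ x 0 = xor b (x 0) := by
  have hfirst (x y : Branch) : φ x 0 = φ y 0 ↔ x 0 = y 0 := by
    simpa [Agree] using φ.agree_map_iff 1 x y
  refine ⟨φ (fun _ => false) 0, fun x => ?_⟩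
  have hx := hfirst x fun _ => false
  revert hx
  cases x 0 <;> cases φ x 0 <;> cases φ (fun _ => false) 0 <;> simp

theorem exists_halves {f f' : Bool → ColouredTree} (φ : TreeEmbedding (join f) (join f')) :
    ∃ (b : Bool) (ψ : ∀ i, TreeEmbedding (f i) (f' (xor b i))),
      ∀ i w, φ (cons i w) = cons (xor b i) (ψ i w) := by
  obtain ⟨b, hb⟩ := φ.exists_apply_zero_eq_xor
  have hφ (i : Bool) (w : Branch) : φ (cons i w) = cons (xor b i) (tail (φ (cons i w))) := by
    conv_lhs => rw [← cons_head_tail (φ (cons i w)), hb]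
    rfl
  refine ⟨b, fun i => ⟨fun w => tail (φ (cons i w)), fun n x y => ?_, fun x => ?_⟩, hφ⟩
  · have h := φ.agree_map_iff (n + 1) (cons i x) (cons i y)
    rwa [hφ, hφ i y, agree_cons_iff, agree_cons_iff, and_iff_right rfl, and_iff_right rfl] at h
  · have h := φ.mult_map (cons i x)
    rwa [hφ] at h

theorem exists_of_hang (h : IsEmpty (TreeEmbedding A P'))
    (φ : TreeEmbedding (hang A P) (hang A' P')) :
    Nonempty (TreeEmbedding P P') ∧
      ∃ ψ : TreeEmbedding A A', ∀ w, φ (cons false w) = cons false (ψ w) := by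
  obtain ⟨_ | _, ψ, hψ⟩ := φ.exists_halves
  · exact ⟨⟨ψ true⟩, ψ false, hψ false⟩
  · exact (h.false (ψ false)).elim

end TreeEmbedding

/-- A family of pairs of coloured trees that is fit for coding the labels of the edges of the full
binary tree: the codes of the two labels of an edge are told apart by embeddings, and no code
hosts a ramified tree, so that embeddings of ramified trees cannot leave the full binary tree. -/
structure IsRigidFamily (W : ℕ → Bool → ColouredTree) : Prop where
  isEmpty_label : ∀ n, IsEmpty (TreeEmbedding (W n false) (W n true))
  isEmpty_ramify : ∀ (n : ℕ) (i : Bool) (Z : Set Branch) (W' : ℕ → Bool → ColouredTree), Dense Z →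
    IsEmpty (TreeEmbedding (ramify Z W') (W n i))

variable {A : ColouredTree} {Z Z' : Set Branch} {W : ℕ → Bool → ColouredTree}

theorem isRigidFamily_hang (hA : ∀ x, A x ≠ 2) (hW : ∀ n, ∃ x, W n false x = 2)
    (hne : ∀ n, IsEmpty (TreeEmbedding (W n false) (W n true))) :
    IsRigidFamily fun n i => hang A (W n i) where
  isEmpty_label n := ⟨fun φ => by
    obtain ⟨_ | _, ψ, -⟩ := φ.exists_halves
    · exact (hne n).false (ψ true)
    · exact (TreeEmbedding.isEmpty_of_mult (hW n) hA).false (ψ true)⟩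
  isEmpty_ramify n i Z W' hZ := ⟨fun φ => by
    rw [ramify_eq_join_hang] at φ
    obtain ⟨b, ψ, -⟩ := φ.exists_halves
    have ψb := ψ b
    obtain ⟨x, hx⟩ :=
      exists_ramify_eq_two (W := fun n => W' (n + 1)) (dense_preimage_cons hZ b).nonempty
    rw [Bool.xor_self] at ψb
    exact (TreeEmbedding.isEmpty_of_mult ⟨cons false x, hx⟩ hA).false ψb⟩

namespace IsRigidFamily

theorem shift (hW : IsRigidFamily W) : IsRigidFamily fun n => W (n + 1) :=
  ⟨fun n => hW.isEmpty_label (n + 1), fun n => hW.isEmpty_ramify (n + 1)⟩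

theorem exists_restrict (hW : IsRigidFamily W) (hZ : Dense Z)
    (φ : TreeEmbedding (ramify Z W) (ramify Z' W)) (i : Bool) :
    ∃ ψ : TreeEmbedding (ramify (cons i ⁻¹' Z) fun n => W (n + 1))
        (ramify (cons i ⁻¹' Z') fun n => W (n + 1)),
      ∀ w, φ (cons i (cons false w)) = cons i (cons false (ψ w)) := by
  obtain ⟨φ', hφ'⟩ : ∃ φ' : TreeEmbedding
      (join fun i => hang (ramify (cons i ⁻¹' Z) fun n => W (n + 1)) (W 0 i))
      (join fun i => hang (ramify (cons i ⁻¹' Z') fun n => W (n + 1)) (W 0 i)),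
      ∀ x, φ' x = φ x := by
    rw [← ramify_eq_join_hang, ← ramify_eq_join_hang]
    exact ⟨φ, fun _ => rfl⟩
  obtain ⟨b, χ, hχ⟩ := φ'.exists_halves
  have hsplit (i : Bool) := (χ i).exists_of_hang
    (hW.isEmpty_ramify 0 (xor b i) _ _ (dense_preimage_cons hZ i))
  cases b
  · obtain ⟨ψ, hψ⟩ := (hsplit i).2
    have hφ (w : Branch) : φ (cons i (cons false w)) = cons (xor false i) (cons false (ψ w)) := by
      rw [← hφ', hχ, hψ]
    cases i <;> exact ⟨ψ, hφ⟩
  · exact ((hW.isEmpty_label 0).false (hsplit false).1.some).elim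

theorem agree_apply_spine (hW : IsRigidFamily W) (hZ : Dense Z)
    (φ : TreeEmbedding (ramify Z W) (ramify Z' W)) (n : ℕ) (z : Branch) :
    Agree (2 * n) (φ (spine z)) (spine z) := by
  induction n generalizing W Z Z' z with
  | zero => exact fun k hk => absurd hk k.not_lt_zero
  | succ n ih =>
    obtain ⟨ψ, hψ⟩ := hW.exists_restrict hZ φ (z 0)
    rw [spine_eq_cons, hψ]
    exact agree_cons_iff.2 ⟨rfl, agree_cons_iff.2
      ⟨rfl, ih hW.shift (dense_preimage_cons hZ _) ψ (tail z)⟩⟩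

theorem apply_spine (hW : IsRigidFamily W) (hZ : Dense Z)
    (φ : TreeEmbedding (ramify Z W) (ramify Z' W)) (z : Branch) : φ (spine z) = spine z :=
  funext fun k => hW.agree_apply_spine hZ φ (k + 1) z k (by omega)

theorem isEmpty_of_mem_of_notMem (hW : IsRigidFamily W) (hZ : Dense Z) {z : Branch} (hz : z ∈ Z)
    (hz' : z ∉ Z') : IsEmpty (TreeEmbedding (ramify Z W) (ramify Z' W)) := by
  refine ⟨fun φ => ?_⟩
  have h := φ.mult_map (spine z)
  rw [hW.apply_spine hZ, ramify_spine, ramify_spine, Set.indicator_of_mem hz,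
    Set.indicator_of_notMem hz'] at h
  exact absurd h (by norm_num)

end IsRigidFamily

end Embedding

section Witness

/-- A coloured tree is admissible if it has countably many branches and they are dense, as is the
case for the tree of a countable model of `REFbin`. -/
structure Admissible (m : ColouredTree) : Prop where
  countable : (Function.support m).Countable
  dense : Dense (Function.support m)

theorem exists_mem_support_join_agree {f : Bool → ColouredTree} {n : ℕ} {x : Branch}
    (h : ∃ y ∈ Function.support (f (x 0)), Agree n y (tail x)) :
    ∃ y ∈ Function.support (join f), Agree (n + 1) y x := by
  obtain ⟨y, hy, hag⟩ := h
  exact ⟨cons (x 0) y, hy, agree_succ_iff_tail.2 ⟨rfl, hag⟩⟩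

theorem Admissible.join {f : Bool → ColouredTree} (h : ∀ i, Admissible (f i)) :
    Admissible (join f) where
  countable := by
    refine (Set.countable_iUnion fun i => countable_preimage_tail (h i).countable).mono ?_
    exact fun x hx => Set.mem_iUnion.2 ⟨x 0, hx⟩
  dense := dense_iff_forall_exists_agree.2 fun n x => by
    obtain ⟨y, hy, hag⟩ := exists_mem_support_join_agree
      (dense_iff_forall_exists_agree.1 (h (x 0)).dense n (tail x))
    exact ⟨y, hy, hag.mono n.le_succ⟩

theorem Admissible.hang {A P : ColouredTree} (hA : Admissible A) (hP : Admissible P) :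
    Admissible (hang A P) :=
  Admissible.join (Bool.forall_bool.2 ⟨hA, hP⟩)

variable {Z : Set Branch} {W : ℕ → Bool → ColouredTree}

theorem countable_support_ramify (hZ : Z.Countable)
    (hW : ∀ n i, (Function.support (W n i)).Countable) :
    (Function.support (ramify Z W)).Countable := by
  refine ((hZ.image spine).union (Set.countable_iUnion fun n => Set.countable_iUnion fun i =>
    countable_preimage_drop (hW n i) (2 * n + 2))).mono fun x hx => ?_
  rcases exists_eq_spine_or x with ⟨z, rfl⟩ | h
  · exact Or.inl ⟨z, mem_of_ramify_spine_ne_zero hx, rfl⟩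
  · rw [Function.mem_support, ramify, dif_pos h] at hx
    exact Or.inr (Set.mem_iUnion.2 ⟨_, Set.mem_iUnion.2 ⟨_, hx⟩⟩)

theorem dense_support_ramify (hW : ∀ n i, Dense (Function.support (W n i))) :
    Dense (Function.support (ramify Z W)) := by
  refine dense_iff_forall_exists_agree.2 fun n x => ?_
  induction n generalizing Z W x with
  | zero =>
    obtain ⟨y, hy⟩ := (hW 0 false).nonempty
    exact ⟨cons false (cons true y), by rwa [Function.mem_support, ramify_cons_true],
      fun k hk => absurd hk k.not_lt_zero⟩
  | succ n ih =>
    obtain ⟨y, hy, hag⟩ : ∃ y ∈ Function.support (ramify Z W), Agree (n + 2) y x := by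
      rw [ramify_eq_join_hang]
      refine exists_mem_support_join_agree (exists_mem_support_join_agree ?_)
      cases tail x 0
      · exact ih (fun n => hW (n + 1)) (tail (tail x))
      · exact dense_iff_forall_exists_agree.1 (hW 0 (x 0)) n (tail (tail x))
    exact ⟨y, hy, hag.mono (n + 1).le_succ⟩

theorem Admissible.ramify (hZ : Z.Countable) (hW : ∀ n i, Admissible (W n i)) :
    Admissible (ramify Z W) :=
  ⟨countable_support_ramify hZ fun n i => (hW n i).countable,
    dense_support_ramify fun n i => (hW n i).dense⟩

/-- The coloured tree in which the eventually vanishing branches have multiplicity `c`. -/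
noncomputable def uniform (c : ℕ) : ColouredTree := (eventuallyConst false).indicator fun _ => c

theorem support_uniform {c : ℕ} (hc : c ≠ 0) :
    Function.support (uniform c) = eventuallyConst false := by
  rw [uniform, Set.support_indicator, Function.support_const hc, Set.inter_univ]

theorem admissible_uniform {c : ℕ} (hc : c ≠ 0) : Admissible (uniform c) where
  countable := by
    rw [support_uniform hc]
    exact countable_eventuallyConst false
  dense := by
    rw [support_uniform hc]
    exact dense_eventuallyConst false

theorem const_mem_eventuallyConst (i : Bool) : (fun _ => i) ∈ eventuallyConst i :=
  Eventually.of_forall fun _ => rfl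

theorem const_notMem_eventuallyConst (i : Bool) : (fun _ => i) ∉ eventuallyConst (!i) := fun h =>
  h.exists.elim fun _ hk => (Bool.eq_not_self i).1 hk

theorem uniform_one_ne_two (x : Branch) : uniform 1 x ≠ 2 := by
  by_cases hx : x ∈ eventuallyConst false <;> simp [uniform, hx]

theorem exists_uniform_eq (c : ℕ) : ∃ x, uniform c x = c :=
  ⟨_, Set.indicator_of_mem (const_mem_eventuallyConst false) _⟩

/-- `P` and `Q` witness that equivalence at level `α` does not imply isomorphism. -/
structure IsWitness (α : Ordinal.{0}) (P Q : ColouredTree) : Prop where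
  admissible_left : Admissible P
  admissible_right : Admissible Q
  exists_eq_two : ∃ x, P x = 2
  isEmpty : IsEmpty (TreeEmbedding P Q)
  sim : Sim α P Q

theorem isWitness_zero : IsWitness 0 (uniform 2) (uniform 1) where
  admissible_left := admissible_uniform two_ne_zero
  admissible_right := admissible_uniform one_ne_zero
  exists_eq_two := exists_uniform_eq 2
  isEmpty := TreeEmbedding.isEmpty_of_mult (exists_uniform_eq 2) uniform_one_ne_two
  sim := by
    rw [Sim]
    exact fun β hβ => absurd hβ not_lt_zero

/-- The trees that code the labels of the `n`-th edges by means of the pair `P n`, `Q n`. The left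
half marks them as codes. -/
noncomputable def edgeLabel (P Q : ℕ → ColouredTree) (n : ℕ) (i : Bool) : ColouredTree :=
  hang (uniform 1) (if i then Q n else P n)

theorem IsWitness.ramify {α : Ordinal.{0}} {s : ℕ → Ordinal.{0}} {P Q : ℕ → ColouredTree}
    (h : ∀ n, IsWitness (s n) (P n) (Q n)) (hs : ∀ γ < α, ∀ᶠ n in atTop, γ ≤ s n) :
    IsWitness α (ramify (eventuallyConst false) (edgeLabel P Q))
      (ramify (eventuallyConst true) (edgeLabel P Q)) := by
  have hadm (n : ℕ) (i : Bool) : Admissible (edgeLabel P Q n i) :=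
    (admissible_uniform one_ne_zero).hang <| by
      cases i
      exacts [(h n).admissible_left, (h n).admissible_right]
  have hrigid : IsRigidFamily (edgeLabel P Q) :=
    isRigidFamily_hang uniform_one_ne_two (fun n => (h n).exists_eq_two) fun n => (h n).isEmpty
  have hsim (n : ℕ) (i i' : Bool) : Sim (s n) (edgeLabel P Q n i) (edgeLabel P Q n i') :=
    (Sim.refl _ _).hang <| by
      cases i <;> cases i'
      exacts [Sim.refl _ _, (h n).sim, (h n).sim.symm, Sim.refl _ _]
  exact {
    admissible_left := Admissible.ramify (countable_eventuallyConst _) hadm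
    admissible_right := Admissible.ramify (countable_eventuallyConst _) hadm
    exists_eq_two := exists_ramify_eq_two (dense_eventuallyConst _).nonempty
    isEmpty := hrigid.isEmpty_of_mem_of_notMem (dense_eventuallyConst _)
      (const_mem_eventuallyConst false) (const_notMem_eventuallyConst false)
    sim := sim_ramify (fun γ hγ => (hs γ hγ).mono fun n hn i i' => (hsim n i i').mono hn)
      (dense_eventuallyConst _) (dense_eventuallyConst _) }

theorem exists_seq_forall_lt_eventually_le {α : Ordinal.{0}} (hα : α < ω_ 1) (h0 : α ≠ 0) :
    ∃ s : ℕ → Ordinal.{0}, (∀ n, s n < α) ∧ ∀ γ < α, ∀ᶠ n in atTop, γ ≤ s n := by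
  have hcount : (Set.Iio α).Countable := by
    rwa [← Cardinal.le_aleph0_iff_set_countable, Cardinal.mk_Iio_ordinal, Cardinal.lift_le_aleph0,
      ← Cardinal.lt_aleph_one_iff, ← Cardinal.lt_ord, Cardinal.ord_aleph]
  have : Countable (Set.Iio α) := hcount
  have : Nonempty (Set.Iio α) := ⟨0, pos_iff_ne_zero.2 h0⟩
  obtain ⟨s, -, hs⟩ := exists_seq_monotone_tendsto_atTop_atTop (Set.Iio α)
  exact ⟨fun n => s n, fun n => (s n).2, fun γ hγ => hs.eventually_ge_atTop ⟨γ, hγ⟩⟩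

theorem exists_isWitness {α : Ordinal.{0}} (hα : α < ω_ 1) : ∃ P Q, IsWitness α P Q := by
  induction α using WellFoundedLT.induction with
  | _ α ih =>
    rcases eq_or_ne α 0 with rfl | h0
    · exact ⟨_, _, isWitness_zero⟩
    · obtain ⟨s, hs, hcofinal⟩ := exists_seq_forall_lt_eventually_le hα h0
      choose P Q h using fun n => ih (s n) (hs n) ((hs n).trans hα)
      exact ⟨_, _, IsWitness.ramify h hcofinal⟩

end Witness

section Turn

variable {m : ColouredTree} {n k : ℕ} {c : Branch}

theorem agree_turn (x : Branch) (n : ℕ) (w : Branch) : Agree n (turn x n w) x := by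
  induction n generalizing x with
  | zero => exact fun k hk => absurd hk k.not_lt_zero
  | succ n ih => exact agree_succ_iff_tail.2 ⟨rfl, ih (tail x)⟩

theorem turn_apply_self (x : Branch) (n : ℕ) (w : Branch) : turn x n w n = !x n := by
  induction n generalizing x with
  | zero => rfl
  | succ _ ih => exact ih (tail x)

theorem eq_turn_drop {x : Branch} (h : Agree n c x) (hne : c n ≠ x n) :
    c = turn x n (drop (n + 1) c) := by
  induction n generalizing c x with
  | zero =>
    rw [turn, ← Bool.eq_not.2 hne]
    exact (cons_head_tail c).symm
  | succ n ih =>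
    obtain ⟨h0, htail⟩ := agree_succ_iff_tail.1 h
    rw [turn, ← h0]
    exact (cons_head_tail c).symm.trans (congrArg (cons (c 0)) (ih htail hne))

theorem turn_turn_of_lt (x w v : Branch) (h : k < n) : turn (turn x n w) k v = turn x k v := by
  induction k generalizing x n with
  | zero =>
    obtain ⟨n, rfl⟩ := Nat.exists_eq_succ_of_ne_zero h.ne'
    rfl
  | succ k ih =>
    obtain ⟨n, rfl⟩ := Nat.exists_eq_succ_of_ne_zero (Nat.ne_zero_of_lt h)
    exact congrArg (cons (x 0)) (ih (tail x) (Nat.lt_of_succ_lt_succ h))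

theorem turn_turn (x w v : Branch) (n k : ℕ) :
    turn (turn x n w) (n + 1 + k) v = turn x n (turn w k v) := by
  induction n generalizing x with
  | zero =>
    rw [Nat.add_comm]
    rfl
  | succ n ih =>
    rw [Nat.add_right_comm]
    exact congrArg (cons (x 0)) (ih (tail x))

theorem sib_turn_of_lt (x w : Branch) (h : k < n) : sib m (turn x n w) k = sib m x k :=
  funext fun v => congrArg m (turn_turn_of_lt x w v h)

theorem sib_turn (x w : Branch) (n k : ℕ) :
    sib m (turn x n w) (n + 1 + k) = sib (sib m x n) w k :=
  funext fun v => congrArg m (turn_turn x w v n k)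

end Turn

section Pattern

theorem agree_equivalence (A : Type*) (n : ℕ) : Equivalence (Agree (A := A) n) :=
  ⟨Agree.refl n, Agree.symm, Agree.trans⟩

theorem rel_option_elim_iff {ι A B : Type*} {r : A → A → Prop} {s : B → B → Prop}
    (hr : Equivalence r) (hs : Equivalence s) {x : ι → A} {y : ι → B} {c : A} {d : B}
    (h : ∀ i j, r (x i) (x j) ↔ s (y i) (y j)) (hcd : ∀ j, r c (x j) ↔ s d (y j)) :
    ∀ p q : Option ι, r (p.elim c x) (q.elim c x) ↔ s (p.elim d y) (q.elim d y)
  | none, none => iff_of_true (hr.refl c) (hs.refl d)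
  | none, some j => hcd j
  | some i, none => ⟨fun hi => hs.symm ((hcd i).1 (hr.symm hi)),
      fun hi => hr.symm ((hcd i).2 (hs.symm hi))⟩
  | some i, some j => h i j

theorem snoc_eq_option_elim_comp {A : Type*} {n : ℕ} (x : Fin n → A) (c : A) :
    (Fin.snoc x c : Fin (n + 1) → A) =
      (fun p : Option (Fin n) => p.elim c x) ∘ (Fin.snoc some none : Fin (n + 1) → _) :=
  (Fin.comp_snoc (fun p : Option (Fin n) => p.elim c x) some none).symm

/-- The families `x` and `y` of branches branch in the same way up to level `N`. -/
def SamePattern (N : ℕ) {ι : Type*} (x y : ι → Branch) : Prop :=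
  ∀ k ≤ N, ∀ i j, Agree k (x i) (x j) ↔ Agree k (y i) (y j)

variable {ι : Type*} {x y : ι → Branch} {c : Branch} {n N : ℕ}

theorem SamePattern.symm (h : SamePattern N x y) : SamePattern N y x :=
  fun k hk i j => (h k hk i j).symm

theorem SamePattern.mono {M : ℕ} (hM : M ≤ N) (h : SamePattern N x y) : SamePattern M x y :=
  fun k hk => h k (hk.trans hM)

theorem exists_forall_not_agree [Finite ι] (h : ∀ i, c ≠ x i) : ∃ n, ∀ i, ¬ Agree n c (x i) := by
  refine (eventually_all.2 fun i => ?_ : ∀ᶠ n in atTop, ∀ i, ¬ Agree n c (x i)).exists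
  obtain ⟨n, hn⟩ := not_forall.1 (mt eq_iff_forall_agree.2 (h i))
  exact (eventually_ge_atTop n).mono fun _ hk hag => hn (hag.mono hk)

theorem exists_last_agree [Nonempty ι] (h : ∃ n, ∀ i, ¬ Agree n c (x i)) :
    ∃ n, (∃ i, Agree n c (x i)) ∧ ∀ j, ¬ Agree (n + 1) c (x j) := by
  have hzero : ¬ ∀ i, ¬ Agree 0 c (x i) := fun h0 =>
    h0 (Classical.arbitrary ι) fun k hk => absurd hk k.not_lt_zero
  obtain ⟨n, hn, hsucc⟩ := Nat.exists_not_and_succ_of_not_zero_of_exists hzero h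
  exact ⟨n, not_forall_not.1 hn, hsucc⟩

theorem SamePattern.agree_iff_of_agree {i : ι} (h : SamePattern N x y) (hc : Agree N c (x i))
    {d : Branch} (hd : Agree N d (y i)) {k : ℕ} (hk : k ≤ N) (j : ι) :
    Agree k c (x j) ↔ Agree k d (y j) := by
  calc Agree k c (x j) ↔ Agree k (x i) (x j) :=
        ⟨(hc.mono hk).symm.trans, (hc.mono hk).trans⟩
    _ ↔ Agree k (y i) (y j) := h k hk i j
    _ ↔ Agree k d (y j) := ⟨(hd.mono hk).trans, (hd.mono hk).symm.trans⟩

theorem SamePattern.not_agree_turn {i : ι} (h : SamePattern (n + 1) x y) (hc : Agree n c (x i))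
    (hturn : ∀ j, ¬ Agree (n + 1) c (x j)) (w : Branch) (j : ι) :
    ¬ Agree (n + 1) (turn (y i) n w) (y j) := by
  intro hj
  have hyij : Agree n (y i) (y j) := (agree_turn _ _ _).symm.trans (hj.mono n.le_succ)
  have hxij : Agree n (x i) (x j) := (h n n.le_succ i j).2 hyij
  have hyne : y i n ≠ y j n := by
    rw [← hj n n.lt_succ_self, turn_apply_self]
    exact (Bool.not_ne_self _).symm
  have hxne : x i n ≠ x j n := fun heq =>
    hyne ((h (n + 1) le_rfl i j).1 (agree_succ_iff.2 ⟨hxij, heq⟩) n n.lt_succ_self)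
  have hcne : c n ≠ x i n := fun heq => hturn i (agree_succ_iff.2 ⟨hc, heq⟩)
  exact hturn j (agree_succ_iff.2
    ⟨hc.trans hxij, (Bool.eq_not.2 hcne).trans (Bool.eq_not.2 hxne.symm).symm⟩)

theorem SamePattern.agree_iff_turn {i : ι} (h : SamePattern (n + 1) x y)
    (hc : Agree n c (x i)) (hturn : ∀ j, ¬ Agree (n + 1) c (x j)) (w : Branch) (k : ℕ) (j : ι) :
    Agree k c (x j) ↔ Agree k (turn (y i) n w) (y j) := by
  rcases le_or_gt k n with hkn | hnk
  · exact (h.mono n.le_succ).agree_iff_of_agree hc (agree_turn _ _ _) hkn j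
  · exact iff_of_false (fun hj => hturn j (hj.mono hnk)) fun hj =>
      h.not_agree_turn hc hturn w j (hj.mono hnk)

theorem SamePattern.exists_agree_iff (h : SamePattern N x y) (c : Branch) :
    ∃ d, ∀ k ≤ N, ∀ j, Agree k c (x j) ↔ Agree k d (y j) := by
  by_cases hN : ∃ i, Agree N c (x i)
  · obtain ⟨i, hi⟩ := hN
    exact ⟨y i, fun k hk => h.agree_iff_of_agree hi (Agree.refl N _) hk⟩
  rw [not_exists] at hN
  rcases isEmpty_or_nonempty ι with _ | _
  · exact ⟨c, fun k _ => isEmptyElim⟩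
  · obtain ⟨n, ⟨i, hi⟩, hturn⟩ := exists_last_agree ⟨N, hN⟩
    have hn : n < N := not_le.1 fun hle => hN i (hi.mono hle)
    exact ⟨turn (y i) n c, fun k _ => (h.mono hn).agree_iff_turn hi hturn c k⟩

end Pattern

section Model

instance : lang.IsRelational := fun _ => inferInstanceAs (IsEmpty Empty)

instance (n : ℕ) : Countable (lang.Relations n) := by
  refine Function.Injective.countable (f := fun R : Rel n => (match R with | .E k => k : ℕ)) ?_
  rintro ⟨a⟩ ⟨b⟩ rfl
  rfl

theorem model_REFbin {A : Type*} [lang.Structure A]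
    (hequiv : ∀ n, Equivalence fun a b : A => Structure.RelMap (sym n) ![a, b])
    (htrivial : ∀ a b : A, Structure.RelMap (sym 0) ![a, b])
    (hrefine : ∀ n (a b : A), Structure.RelMap (sym (n + 1)) ![a, b] →
      Structure.RelMap (sym n) ![a, b])
    (hsplit : ∀ n (a : A), ∃ b, Structure.RelMap (sym n) ![a, b] ∧
      ¬ Structure.RelMap (sym (n + 1)) ![a, b] ∧ ∀ c, Structure.RelMap (sym n) ![a, c] →
        Structure.RelMap (sym (n + 1)) ![a, c] ∨ Structure.RelMap (sym (n + 1)) ![b, c]) :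
    A ⊨ REFbin := by
  refine ⟨fun φ hφ => ?_⟩
  rcases hφ with ((((⟨n, rfl⟩ | ⟨n, rfl⟩) | ⟨n, rfl⟩) | rfl) | ⟨n, rfl⟩) | ⟨n, rfl⟩
  · exact Relations.realize_reflexive.2 ⟨(hequiv n).refl⟩
  · exact Relations.realize_symmetric.2 ⟨fun _ _ => (hequiv n).symm⟩
  · exact Relations.realize_transitive.2 ⟨fun _ _ _ => (hequiv n).trans⟩
  · simp only [trivialAxiom, atom, Sentence.Realize, Formula.Realize, BoundedFormula.realize_all,
      BoundedFormula.realize_rel₂]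
    exact htrivial
  · simp only [refineAxiom, atom, Sentence.Realize, Formula.Realize, BoundedFormula.realize_all,
      BoundedFormula.realize_imp, BoundedFormula.realize_rel₂]
    exact hrefine n
  · simp only [splitAxiom, atom, Sentence.Realize, Formula.Realize, BoundedFormula.realize_all,
      BoundedFormula.realize_ex, BoundedFormula.realize_inf, BoundedFormula.realize_sup,
      BoundedFormula.realize_not, BoundedFormula.realize_imp, BoundedFormula.realize_rel₂]
    exact hsplit n

/-- The interpretation of the relation symbols given by the map `f` from elements to branches:
`E n` relates the elements whose branches agree up to level `n`. -/
def relOfMap (f : ℕ → Branch) : ∀ {n : ℕ}, Rel n → (Fin n → ℕ) → Prop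
  | _, Rel.E n, v => Agree n (f (v 0)) (f (v 1))

/-- The structure with universe `ℕ` in which the `E n`-class of `i` is given by the initial
segment of length `n` of the branch `f i`. It is a model of `REFbin` if `f` has dense range. -/
def ofMap (f : ℕ → Branch) : StructureSpace lang where
  funMap F _ := F.elim
  RelMap R v := relOfMap f R v

theorem exists_agree_of_denseRange {I : Type*} {f : I → Branch} (hf : DenseRange f) (n : ℕ)
    (x : Branch) : ∃ k, Agree n (f k) x := by
  obtain ⟨_, ⟨k, rfl⟩, hk⟩ := dense_iff_forall_exists_agree.1 hf n x
  exact ⟨k, hk⟩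

theorem ofMap_mem_modelSpace {f : ℕ → Branch} (hf : DenseRange f) :
    ofMap f ∈ ModelSpace REFbin := by
  refine @model_REFbin ℕ (ofMap f) (fun n => (agree_equivalence Bool n).comap f)
    (fun a b k hk => absurd hk k.not_lt_zero) (fun n a b h => Agree.mono n.le_succ h)
    fun n a => ?_
  obtain ⟨b, hb⟩ := exists_agree_of_denseRange hf (n + 1) (turn (f a) n (f a))
  have hbn : f b n = !f a n := by rw [hb n n.lt_succ_self, turn_apply_self]
  have hab : Agree n (f a) (f b) := ((hb.mono n.le_succ).trans (agree_turn _ _ _)).symm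
  refine ⟨b, hab, fun h => ?_, fun c (hac : Agree n (f a) (f c)) => ?_⟩
  · exact (Bool.not_ne_self _) (hbn.symm.trans (h n n.lt_succ_self).symm)
  · by_cases hn : f a n = f c n
    · exact Or.inl (agree_succ_iff.2 ⟨hac, hn⟩)
    · exact Or.inr (agree_succ_iff.2
        ⟨hab.symm.trans hac, hbn.trans (Bool.eq_not.2 (Ne.symm hn)).symm⟩)

end Model

section Elementary

/-- The tuples `a` and `b` satisfy the same atomic formulas in the language `{E 0, …, E N}`, in the
structures given by `f` and `g`. -/
structure SameType (N : ℕ) (f g : ℕ → Branch) {ι : Type*} (a b : ι → ℕ) : Prop where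
  eq_iff : ∀ i j, a i = a j ↔ b i = b j
  pattern : SamePattern N (f ∘ a) (g ∘ b)

variable {N : ℕ} {f g : ℕ → Branch} {ι : Type*} {a b : ι → ℕ}

theorem SameType.symm (h : SameType N f g a b) : SameType N g f b a :=
  ⟨fun i j => (h.eq_iff i j).symm, h.pattern.symm⟩

theorem SameType.mono {M : ℕ} (hM : M ≤ N) (h : SameType N f g a b) : SameType M f g a b :=
  ⟨h.eq_iff, h.pattern.mono hM⟩

theorem SameType.comp (h : SameType N f g a b) {κ : Type*} (σ : κ → ι) :
    SameType N f g (a ∘ σ) (b ∘ σ) :=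
  ⟨fun i j => h.eq_iff (σ i) (σ j), fun k hk i j => h.pattern k hk (σ i) (σ j)⟩

instance (x : Branch) : (𝓝[≠] x).NeBot := by
  refine ⟨mt (isOpen_singleton_iff_punctured_nhds x).2 fun hx => ?_⟩
  obtain ⟨n, hn⟩ := exists_forall_agree_mem hx rfl
  have hturn := turn_apply_self x n x
  rw [hn _ (agree_turn x n x)] at hturn
  exact (Bool.not_ne_self _).symm hturn

theorem exists_agree_forall_ne (hf : DenseRange f) [Finite ι] (b : ι → ℕ) (n : ℕ) (x : Branch) :
    ∃ k, Agree n (f k) x ∧ ∀ i, k ≠ b i := by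
  have hdense : Dense (Set.range f \ f '' Set.range b) :=
    hf.sdiff_finite ((Set.finite_range b).image f)
  obtain ⟨_, ⟨⟨k, rfl⟩, hk⟩, hag⟩ := dense_iff_forall_exists_agree.1 hdense n x
  exact ⟨k, hag, fun i hi => hk ⟨k, ⟨i, hi.symm⟩, rfl⟩⟩

theorem SameType.exists_option [Finite ι] (h : SameType N f g a b) (hg : DenseRange g) (c : ℕ) :
    ∃ d, SameType N f g (fun p : Option ι => p.elim c a) (fun p => p.elim d b) := by
  suffices ∃ d, (∀ i, c = a i ↔ d = b i) ∧
      ∀ k ≤ N, ∀ i, Agree k (f c) (f (a i)) ↔ Agree k (g d) (g (b i)) by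
    obtain ⟨d, heq, hag⟩ := this
    exact ⟨d, rel_option_elim_iff eq_equivalence eq_equivalence h.eq_iff heq, fun k hk =>
      rel_option_elim_iff ((agree_equivalence _ k).comap f) ((agree_equivalence _ k).comap g)
        (h.pattern k hk) (hag k hk)⟩
  by_cases hc : ∃ i, c = a i
  · obtain ⟨i, rfl⟩ := hc
    exact ⟨b i, h.eq_iff i, fun k hk => h.pattern k hk i⟩
  · obtain ⟨y, hy⟩ := h.pattern.exists_agree_iff (f c)
    obtain ⟨d, hd, hdb⟩ := exists_agree_forall_ne hg b N y
    exact ⟨d, fun i => iff_of_false (not_exists.1 hc i) (hdb i), fun k hk i => (hy k hk i).trans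
      ⟨(hd.mono hk).trans, (hd.mono hk).symm.trans⟩⟩

theorem sum_elim_snoc {A I : Type*} {k : ℕ} (v : I → A) (xs : Fin k → A) (c : A) :
    Sum.elim v (Fin.snoc xs c : Fin (k + 1) → A) =
      (fun p : Option (I ⊕ Fin k) => p.elim c (Sum.elim v xs)) ∘
        Sum.elim (some ∘ Sum.inl) (Fin.snoc (some ∘ Sum.inr) none : Fin (k + 1) → _) := by
  rw [Sum.comp_elim, Fin.comp_snoc]
  rfl

theorem SameType.exists_snoc {I : Type*} [Finite I] {k : ℕ} {v v' : I → ℕ} {xs xs' : Fin k → ℕ}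
    (h : SameType N f g (Sum.elim v xs) (Sum.elim v' xs')) (hg : DenseRange g) (c : ℕ) :
    ∃ d, SameType N f g (Sum.elim v (Fin.snoc xs c : Fin (k + 1) → ℕ))
      (Sum.elim v' (Fin.snoc xs' d : Fin (k + 1) → ℕ)) := by
  obtain ⟨d, hd⟩ := h.exists_option hg c
  refine ⟨d, ?_⟩
  rw [sum_elim_snoc v xs c, sum_elim_snoc v' xs' d]
  exact hd.comp _

theorem exists_eq_var {I : Type*} (t : lang.Term I) : ∃ i, t = Term.var i := by
  cases t with
  | var i => exact ⟨i, rfl⟩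
  | func F _ => exact F.elim

/-- Truth of `φ` at `v, xs` in the structure given by `f`. -/
abbrev RealizeOfMap (f : ℕ → Branch) {I : Type*} {k : ℕ} (φ : lang.BoundedFormula I k) (v : I → ℕ)
    (xs : Fin k → ℕ) : Prop :=
  @BoundedFormula.Realize lang ℕ (ofMap f) I k φ v xs

/-- Quantifier elimination, by way of the back-and-forth property of `SameType`. -/
theorem exists_realize_iff {I : Type*} [Finite I] {k : ℕ} (φ : lang.BoundedFormula I k) :
    ∃ N, ∀ f g : ℕ → Branch, DenseRange f → DenseRange g → ∀ v v' xs xs',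
      SameType N f g (Sum.elim v xs) (Sum.elim v' xs') →
        (RealizeOfMap f φ v xs ↔ RealizeOfMap g φ v' xs') := by
  induction φ with
  | falsum => exact ⟨0, fun _ _ _ _ _ _ _ _ _ => Iff.rfl⟩
  | equal t₁ t₂ =>
    obtain ⟨i, rfl⟩ := exists_eq_var t₁
    obtain ⟨j, rfl⟩ := exists_eq_var t₂
    exact ⟨0, fun f g _ _ v v' xs xs' h => h.eq_iff i j⟩
  | rel R ts =>
    obtain ⟨m⟩ := R
    choose i hi using fun l => exists_eq_var (ts l)
    obtain rfl : ts = fun l => Term.var (i l) := funext hi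
    exact ⟨m, fun f g _ _ v v' xs xs' h => h.pattern m le_rfl (i 0) (i 1)⟩
  | imp φ ψ ihφ ihψ =>
    obtain ⟨N₁, h₁⟩ := ihφ
    obtain ⟨N₂, h₂⟩ := ihψ
    exact ⟨max N₁ N₂, fun f g hf hg v v' xs xs' h => imp_congr
      (h₁ f g hf hg v v' xs xs' (h.mono (le_max_left _ _)))
      (h₂ f g hf hg v v' xs xs' (h.mono (le_max_right _ _)))⟩
  | all φ ih =>
    obtain ⟨N, hN⟩ := ih
    refine ⟨N, fun f g hf hg v v' xs xs' h => ⟨fun H d => ?_, fun H c => ?_⟩⟩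
    · obtain ⟨c, hc⟩ := h.symm.exists_snoc hf d
      exact (hN f g hf hg _ _ _ _ hc.symm).1 (H c)
    · obtain ⟨d, hd⟩ := h.exists_snoc hg c
      exact (hN f g hf hg _ _ _ _ hd).2 (H d)

theorem partialElementary_ofMap (hf : DenseRange f) (hg : DenseRange g) {n : ℕ}
    {a b : Fin n → ℕ} (h : ∀ N, SameType N f g a b) :
    PartialElementary (ofMap f) (ofMap g) a b := by
  intro φ
  obtain ⟨N, hN⟩ := exists_realize_iff φ
  have helim (v : Fin n → ℕ) (xs : Fin 0 → ℕ) : Sum.elim v xs = v ∘ Sum.elim id Fin.elim0 :=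
    funext (Sum.rec (fun _ => rfl) fun i => i.elim0)
  refine hN f g hf hg a b _ _ ?_
  rw [helim, helim]
  exact (h N).comp _

end Elementary

section Position

variable {β γ : Ordinal.{0}} {m m' : ColouredTree} {n : ℕ} {x y : Fin n → Branch} {c d : Branch}

/-- A position of the game on coloured trees which is good for Player II with the clock at `β`: the
chosen branches correspond to each other, and so do the parts of the trees that contain none of
them. Such a part leaves some `x i` at a level `k` at which no chosen branch leaves `x i`; before
the first move it is the whole tree. -/
structure Position (β : Ordinal.{0}) (m m' : ColouredTree) (x y : Fin n → Branch) : Prop where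
  initial : n = 0 → Sim β m m'
  mult : ∀ i, m' (y i) = m (x i)
  pattern : ∀ N, SamePattern N x y
  sim_sib : ∀ i k, (∀ j, Agree k (x j) (x i) → Agree (k + 1) (x j) (x i)) →
    Sim β (sib m (x i) k) (sib m' (y i) k)

theorem Position.symm (h : Position β m m' x y) : Position β m' m y x where
  initial hn := (h.initial hn).symm
  mult i := (h.mult i).symm
  pattern N := (h.pattern N).symm
  sim_sib i k hik := (h.sim_sib i k fun j hj => (h.pattern _ (k + 1) le_rfl j i).2
    (hik j ((h.pattern _ k le_rfl j i).1 hj))).symm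

theorem Position.snoc (hγ : γ ≤ β) (h : Position β m m' x y) (hm : m' d = m c)
    (hag : ∀ k j, Agree k c (x j) ↔ Agree k d (y j))
    (hs : ∀ k, (∀ j, Agree k (x j) c → Agree (k + 1) (x j) c) → Sim γ (sib m c k) (sib m' d k)) :
    Position γ m m' (Fin.snoc x c : Fin (n + 1) → Branch) (Fin.snoc y d) where
  initial hn := absurd hn n.succ_ne_zero
  mult i := by
    refine Fin.lastCases ?_ (fun i => ?_) i
    · simpa only [Fin.snoc_last] using hm
    · simpa only [Fin.snoc_castSucc] using h.mult i
  pattern N k hk i j := by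
    rw [snoc_eq_option_elim_comp, snoc_eq_option_elim_comp y]
    exact rel_option_elim_iff (agree_equivalence Bool k) (agree_equivalence Bool k)
      (h.pattern N k hk) (hag k) _ _
  sim_sib i k := by
    refine Fin.lastCases ?_ (fun i => ?_) i <;>
      simp only [Fin.snoc_last, Fin.snoc_castSucc] <;> intro H
    · exact hs k fun j => by simpa only [Fin.snoc_castSucc] using H j.castSucc
    · exact (h.sim_sib i k fun j => by simpa only [Fin.snoc_castSucc] using H j.castSucc).mono hγ

theorem Position.exists_snoc_initial {x y : Fin 0 → Branch} (h : Position β m m' x y) (hγ : γ < β)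
    (hc : m c ≠ 0) : ∃ d, m' d = m c ∧
      Position γ m m' (Fin.snoc x c : Fin 1 → Branch) (Fin.snoc y d) := by
  have h0 := h.initial rfl
  rw [Sim] at h0
  obtain ⟨d, hd, hsib⟩ := (h0 γ hγ).1 c hc
  exact ⟨d, hd, h.snoc hγ.le hd (fun _ j => j.elim0) fun k _ => hsib k⟩

theorem Position.snoc_of_repeat (h : Position β m m' x y) (hγ : γ ≤ β) (i : Fin n) :
    Position γ m m' (Fin.snoc x (x i) : Fin (n + 1) → Branch) (Fin.snoc y (y i)) :=
  h.snoc hγ (h.mult i) (fun k => h.pattern k k le_rfl i) fun k H => (h.sim_sib i k H).mono hγ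

theorem Position.exists_snoc_turn (h : Position β m m' x y) (hγ : γ < β) {k : ℕ} {i : Fin n}
    (hi : Agree k c (x i)) (hturn : ∀ j, ¬ Agree (k + 1) c (x j)) (hc : m c ≠ 0) :
    ∃ d, m' d = m c ∧ Position γ m m' (Fin.snoc x c : Fin (n + 1) → Branch) (Fin.snoc y d) := by
  have hne (j : Fin n) (hj : Agree k c (x j)) : c k ≠ x j k := fun heq =>
    hturn j (agree_succ_iff.2 ⟨hj, heq⟩)
  have hsim : Sim β (sib m (x i) k) (sib m' (y i) k) := h.sim_sib i k fun j hj =>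
    agree_succ_iff.2 ⟨hj, (Bool.eq_not.2 (hne j (hi.trans hj.symm)).symm).trans
      (Bool.eq_not.2 (hne i hi).symm).symm⟩
  obtain ⟨w, rfl⟩ : ∃ w, c = turn (x i) k w := ⟨_, eq_turn_drop hi (hne i hi)⟩
  rw [Sim] at hsim
  obtain ⟨w', hw', hsib⟩ := (hsim γ hγ).1 w hc
  refine ⟨turn (y i) k w', hw', h.snoc hγ.le hw'
    (fun l => (h.pattern _).agree_iff_turn hi hturn w' l) fun l H => ?_⟩
  rcases lt_trichotomy l k with hl | rfl | hl
  · rw [sib_turn_of_lt _ _ hl, sib_turn_of_lt _ _ hl]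
    exact (h.sim_sib i l fun j hj =>
      (H j (hj.trans (hi.mono hl.le).symm)).trans (hi.mono hl)).mono hγ.le
  · exact absurd (H i hi.symm).symm (hturn i)
  · obtain ⟨l, rfl⟩ := Nat.exists_eq_add_of_le (Nat.succ_le_of_lt hl)
    rw [sib_turn, sib_turn]
    exact hsib l

theorem Position.exists_snoc (h : Position β m m' x y) (hγ : γ < β) (hc : m c ≠ 0) :
    ∃ d, m' d = m c ∧ Position γ m m' (Fin.snoc x c : Fin (n + 1) → Branch) (Fin.snoc y d) := by
  rcases n.eq_zero_or_pos with rfl | hn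
  · exact h.exists_snoc_initial hγ hc
  by_cases hcx : ∃ i, c = x i
  · obtain ⟨i, rfl⟩ := hcx
    exact ⟨y i, h.mult i, h.snoc_of_repeat hγ.le i⟩
  · have : Nonempty (Fin n) := ⟨⟨0, hn⟩⟩
    obtain ⟨k, ⟨i, hi⟩, hturn⟩ := exists_last_agree (exists_forall_not_agree (not_exists.1 hcx))
    exact h.exists_snoc_turn hγ hi hturn hc

end Position

section Point

variable {m m' : ColouredTree}

/-- The points of a coloured tree: its branches, repeated according to their multiplicities. -/
abbrev Point (m : ColouredTree) : Type := Σ x, Fin (m x)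

theorem point_eq_iff {p q : Point m} : p = q ↔ p.1 = q.1 ∧ (p.2 : ℕ) = q.2 := by
  refine ⟨fun h => h ▸ ⟨rfl, rfl⟩, fun ⟨h1, h2⟩ => ?_⟩
  exact Sigma.ext h1 ((Fin.heq_ext_iff (congrArg m h1)).2 h2)

theorem Admissible.nonempty_equiv (h : Admissible m) : Nonempty (ℕ ≃ Point m) := by
  have : Countable (Function.support m) := h.countable
  have : Infinite (Function.support m) := by
    refine Set.infinite_coe_iff.2 fun hfin => ?_
    simpa using (h.dense.sdiff_finite hfin).nonempty
  have hpos (x : Function.support m) : 0 < m x := Nat.pos_of_ne_zero x.2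
  have : Countable (Point m) := by
    refine Function.Injective.countable
      (f := fun p : Point m => ((⟨p.1, p.2.pos.ne'⟩ : Function.support m), (p.2 : ℕ)))
      fun p q hpq => ?_
    exact point_eq_iff.2 ⟨congrArg (fun r => r.1.1) hpq, congrArg Prod.snd hpq⟩
  have : Infinite (Point m) :=
    Infinite.of_injective (fun x : Function.support m => (⟨x, 0, hpos x⟩ : Point m))
      fun x y hxy => Subtype.ext (point_eq_iff.1 hxy).1
  exact nonempty_equiv_of_countable

/-- The branch of the point with number `k`. -/
def proj (e : ℕ ≃ Point m) (k : ℕ) : Branch := (e k).1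

/-- The index of the point with number `k` among the points on the same branch. -/
def copy (e : ℕ ≃ Point m) (k : ℕ) : ℕ := (e k).2

theorem Admissible.denseRange_proj (h : Admissible m) (e : ℕ ≃ Point m) :
    DenseRange (proj e) :=
  h.dense.mono fun x hx => ⟨e.symm ⟨x, 0, Nat.pos_of_ne_zero hx⟩, by simp [proj]⟩

theorem eq_iff_proj_copy (e : ℕ ≃ Point m) {i j : ℕ} :
    i = j ↔ proj e i = proj e j ∧ copy e i = copy e j :=
  e.injective.eq_iff.symm.trans point_eq_iff

variable {β γ : Ordinal.{0}} {n : ℕ} {a b : Fin n → ℕ} {e : ℕ ≃ Point m}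
  {e' : ℕ ≃ Point m'}

theorem Position.exists_point_snoc
    (h : Position β m m' (proj e ∘ a) (proj e' ∘ b)) (hab : copy e ∘ a = copy e' ∘ b)
    (hγ : γ < β) (c : ℕ) :
    ∃ d, Position γ m m' (proj e ∘ (Fin.snoc a c : Fin (n + 1) → ℕ)) (proj e' ∘ Fin.snoc b d) ∧
      copy e ∘ (Fin.snoc a c : Fin (n + 1) → ℕ) = copy e' ∘ Fin.snoc b d := by
  obtain ⟨y, hy, hpos⟩ := h.exists_snoc hγ (c := proj e c) (e c).2.pos.ne'
  let d := e'.symm ⟨y, copy e c, hy ▸ (e c).2.2⟩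
  have hproj : proj e' d = y := congrArg Sigma.fst (e'.apply_symm_apply _)
  have hcopy : copy e' d = copy e c :=
    congrArg (fun p : Point m' => (p.2 : ℕ)) (e'.apply_symm_apply _)
  refine ⟨d, ?_, ?_⟩
  · rwa [Fin.comp_snoc, Fin.comp_snoc, hproj]
  · rw [Fin.comp_snoc, Fin.comp_snoc, hcopy, hab]

theorem Position.sameType
    (h : Position β m m' (proj e ∘ a) (proj e' ∘ b)) (hab : copy e ∘ a = copy e' ∘ b) (N : ℕ) :
    SameType N (proj e) (proj e') a b where
  eq_iff i j := by
    have hcopy (i : Fin n) : copy e (a i) = copy e' (b i) := congrFun hab i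
    rw [eq_iff_proj_copy e, eq_iff_proj_copy e' (i := b i), hcopy, hcopy, eq_iff_forall_agree,
      eq_iff_forall_agree]
    exact and_congr_left' (forall_congr' fun k => h.pattern k k le_rfl i j)
  pattern := h.pattern N

theorem Position.playerTwoWins
    (he : DenseRange (proj e)) (he' : DenseRange (proj e'))
    (h : Position β m m' (proj e ∘ a) (proj e' ∘ b)) (hab : copy e ∘ a = copy e' ∘ b) :
    PlayerTwoWins (ofMap (proj e)) (ofMap (proj e')) β a b := by
  induction β using WellFoundedLT.induction generalizing n with
  | _ β ih =>
    rw [PlayerTwoWins]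
    refine ⟨partialElementary_ofMap he he' (h.sameType hab), fun γ hγ => ⟨fun c => ?_, fun d => ?_⟩⟩
    · obtain ⟨d, hpos, hcopy⟩ := h.exists_point_snoc hab hγ c
      exact ⟨d, ih γ hγ hpos hcopy⟩
    · obtain ⟨c, hpos, hcopy⟩ := h.symm.exists_point_snoc hab.symm hγ d
      exact ⟨c, ih γ hγ hpos.symm hcopy.symm⟩

theorem Sim.equivUpTo {α : Ordinal.{0}} (h : Sim α m m')
    (he : DenseRange (proj e)) (he' : DenseRange (proj e')) :
    EquivUpTo α (ofMap (proj e)) (ofMap (proj e')) :=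
  Position.playerTwoWins he he'
    ⟨fun _ => h, fun i => i.elim0, fun _ _ _ i => i.elim0, fun i => i.elim0⟩
    (funext fun i => i.elim0)

theorem card_proj_eq (e : ℕ ≃ Point m) (x : Branch) : Nat.card {k // proj e k = x} = m x := by
  have hfibre : {k // proj e k = x} ≃ Fin (m x) :=
    (e.subtypeEquiv fun _ => Iff.rfl).trans (Equiv.sigmaSubtype x)
  rw [Nat.card_congr hfibre, Nat.card_fin]

theorem exists_equiv_of_iso {f g : ℕ → Branch} (h : Iso (ofMap f) (ofMap g)) :
    ∃ σ : ℕ ≃ ℕ, ∀ n i j, Agree n (g (σ i)) (g (σ j)) ↔ Agree n (f i) (f j) := by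
  obtain ⟨s⟩ := h
  exact ⟨@Language.Equiv.toEquiv lang ℕ ℕ (ofMap f) (ofMap g) s, fun n i j =>
    @Language.Equiv.map_rel lang ℕ ℕ (ofMap f) (ofMap g) s 2 (sym n) ![i, j]⟩

theorem exists_isometric_extension {I : Type*} {f g : I → Branch} (hf : DenseRange f)
    (hfg : ∀ n i j, Agree n (g i) (g j) ↔ Agree n (f i) (f j)) :
    ∃ φ : Branch → Branch, (∀ i, φ (f i) = g i) ∧
      ∀ n x y, Agree n (φ x) (φ y) ↔ Agree n x y := by
  choose near hnear using exists_agree_of_denseRange hf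
  let φ : Branch → Branch := fun x k => g (near (k + 1) x) k
  have hφ (n : ℕ) (i : I) (x : Branch) (hi : Agree n (f i) x) : Agree n (g i) (φ x) := fun k hk =>
    (hfg (k + 1) _ _).2 ((hi.mono hk).trans (hnear (k + 1) x).symm) k k.lt_succ_self
  refine ⟨φ, fun i => eq_iff_forall_agree.2 fun n => (hφ n i _ (Agree.refl n _)).symm,
    fun n x y => ?_⟩
  have hx := hφ n _ x (hnear n x)
  have hy := hφ n _ y (hnear n y)
  calc Agree n (φ x) (φ y) ↔ Agree n (g (near n x)) (g (near n y)) :=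
        ⟨fun h => (hx.trans h).trans hy.symm, fun h => (hx.symm.trans h).trans hy⟩
    _ ↔ Agree n (f (near n x)) (f (near n y)) := hfg n _ _
    _ ↔ Agree n x y := ⟨fun h => ((hnear n x).symm.trans h).trans (hnear n y),
        fun h => ((hnear n x).trans h).trans (hnear n y).symm⟩

theorem nonempty_treeEmbedding_of_iso
    (he : DenseRange (proj e)) (h : Iso (ofMap (proj e)) (ofMap (proj e'))) :
    Nonempty (TreeEmbedding m m') := by
  obtain ⟨σ, hσ⟩ := exists_equiv_of_iso h
  obtain ⟨φ, hφ, hiso⟩ := exists_isometric_extension (g := proj e' ∘ σ) he hσ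
  have hinj : Function.Injective φ := fun x y hxy =>
    eq_iff_forall_agree.2 fun n => (hiso n x y).1 (eq_iff_forall_agree.1 hxy n)
  refine ⟨⟨φ, hiso, fun x => ?_⟩⟩
  rw [← card_proj_eq e x, ← card_proj_eq e' (φ x)]
  refine (Nat.card_congr (σ.subtypeEquiv fun k => ?_)).symm
  rw [← hinj.eq_iff, hφ, Function.comp_apply]

theorem exists_equivUpTo_not_iso {α : Ordinal.{0}} (hα : α < ω_ 1) :
    ∃ M ∈ ModelSpace REFbin, ∃ N ∈ ModelSpace REFbin, ¬ Iso M N ∧ EquivUpTo α M N := by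
  obtain ⟨P, Q, h⟩ := exists_isWitness hα
  obtain ⟨e⟩ := h.admissible_left.nonempty_equiv
  obtain ⟨e'⟩ := h.admissible_right.nonempty_equiv
  have he := h.admissible_left.denseRange_proj e
  have he' := h.admissible_right.denseRange_proj e'
  refine ⟨_, ofMap_mem_modelSpace he, _, ofMap_mem_modelSpace he', fun hiso => ?_,
    h.sim.equivUpTo he he'⟩
  exact not_isEmpty_iff.2 (nonempty_treeEmbedding_of_iso he hiso) h.isEmpty

end Point

end RefBin

theorem mainTheorem6 :
    ¬ CountableModels.IsomorphismIsBorel RefBin.REFbin ∧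
      ∀ α : Ordinal.{0}, α < Ordinal.omega 1 →
        ∃ M ∈ CountableModels.ModelSpace RefBin.REFbin, ∃ N ∈ CountableModels.ModelSpace RefBin.REFbin,
          ¬ CountableModels.Iso M N ∧ CountableModels.EquivUpTo α M N := by
  refine ⟨fun h => ?_, fun α hα => RefBin.exists_equivUpTo_not_iso hα⟩
  obtain ⟨α, hα, H⟩ := h.exists_level
  obtain ⟨M, hM, N, hN, hMN, heq⟩ := RefBin.exists_equivUpTo_not_iso hα
  exact hMN (H M hM N hN heq)
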